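/- **Lemma (Entropy flux kernel).** Let $0<\varepsilon<1$. In terms of the Riemann invariants $(w,z)\in\mathbb R^2$, consider the isothermal relativistic Euler equations (sound speed $1$, light speed $1/\varepsilon$), where $\bar u(v)=\frac{w+z}2$ and $\rho=e^{(1+\varepsilon^2)(w-z)/2}$. Their characteristic speeds are $$\lambda_1(w,z)=-\frac1\varepsilon\,\frac{1+\varepsilon-(1-\varepsilon)e^{\varepsilon(w+z)}}{1+\varepsilon+(1-\varepsilon)e^{\varepsilon(w+z)}},\qquad \lambda_2(w,z)=-\frac1\varepsilon\,\frac{1-\varepsilon-(1+\varepsilon)e^{\varepsilon(w+z)}}{1-\varepsilon+(1+\varepsilon)e^{\varepsilon(w+z)}}.$$ Put $$\bar a(\xi)=-\frac{1-\varepsilon^2}4\,\frac{1-\varepsilon+(1+\varepsilon)e^{\varepsilon\xi}}{1+\varepsilon+(1-\varepsilon)e^{\varepsilon\xi}},\qquad \bar b(\xi)=-\bar a(-\xi).$$ There is exactly one Riemann function $\mathcal R(w',z';w,z)$, that is, for every $(w,z)$ the map $(w',z')\mapsto\mathcal R(w',z';w,z)$ is of class $C^2$ on $\mathbb R^2$ and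 solves the Goursat problem $$\mathcal R_{w'z'}-(\bar b(w'+z')\mathcal R)_{w'}-(\bar a(w'+z')\mathcal R)_{z'}=0,$$ $$\mathcal R_{w'}=\bar a(w'+z)\,\mathcal R\ \text{ on } z'=z,\qquad \mathcal R_{z'}=\bar b(w+z')\,\mathcal R\ \text{ on } w'=w,\qquad \mathcal R(w,z;w,z)=1,$$ and $(w,z)\mapsto\mathcal R(0,0;w,z)$ is $C^\infty$ on $\mathbb R^2$. Let the entropy kernel be $\chi(w,z)=\mathcal R(0,0;w,z)$ for $wz\le0$ and $\chi(w,z)=0$ for $wz>0$, and let $C_1(w,z)=\partial_w\mathcal R(0,0;w,z)$ and $C_2(w,z)=\partial_z\mathcal R(0,0;w,z)$, which on $\{wz<0\}$ are the regular parts of $\chi_w$ and $\chi_z$. There is a locally integrable function $\sigma$ on $\{w\ne z\}$, unique up to null sets, such that $$\sigma_w=\lambda_2\,\chi_w,\qquad \sigma_z=\lambda_1\,\chi_z$$ in the sense of distributions in each of the regions $\rho<1$ (i.e. $w<z$) and $\rho>1$ (i.e. $w>z$), and such that $\sigma^\sharp:=\sigma-\bar u(v)\,\chi=\sigma-\frac{w+z}2\,\chi$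 satisfies $\sigma^\sharp(0,0)=0$, meaning that $\sigma^\sharp(w,z)\to0$ as $(w,z)\to(0,0)$ within $\{wz<0\}$. Moreover, in the sense of distributions in each of the regions $\rho<1$ and $\rho>1$, $$\sigma^\sharp_w=C_5(z)\,e^{-(1+\varepsilon)^2z/4}\,\delta_{w=0}+C_3(w,z)\,\mathbf 1_{wz<0},$$ $$\sigma^\sharp_z=C_6(w)\,e^{(1-\varepsilon)^2w/4}\,\delta_{z=0}+C_4(w,z)\,\mathbf 1_{wz<0},$$ where $$C_3=\Big(\lambda_2-\frac{w+z}2\Big)C_1-\frac12\chi,\qquad C_4=\Big(\lambda_1-\frac{w+z}2\Big)C_2-\frac12\chi,$$ $$C_5(z)=|z|\,\frac{1-\varepsilon+(1+\varepsilon)e^{\varepsilon z}}4+(\operatorname{sgn}z)\,\frac{1-\varepsilon-(1+\varepsilon)e^{\varepsilon z}}{2\varepsilon},$$ $$C_6(w)=|w|\,\frac{1+\varepsilon+(1-\varepsilon)e^{\varepsilon w}}4+(\operatorname{sgn}w)\,\frac{1+\varepsilon-(1-\varepsilon)e^{\varepsilon w}}{2\varepsilon}.$$ -/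

import Mathlib

open MeasureTheory Filter Topology
open scoped ContDiff

namespace RelEuler

noncomputable section

/-- The slow characteristic speed as a function of the Riemann invariants `w, z`; it equals
`(v - 1) / (1 - ε ^ 2 * v)` for the velocity `v = tanh (ε * (w + z) / 2) / ε`. -/
def lam1 (ε w z : ℝ) : ℝ :=
  -(1 / ε) * ((1 + ε - (1 - ε) * Real.exp (ε * (w + z))) /
    (1 + ε + (1 - ε) * Real.exp (ε * (w + z))))

/-- The fast characteristic speed; it equals `(v + 1) / (1 + ε ^ 2 * v)`. -/
def lam2 (ε w z : ℝ) : ℝ :=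
  -(1 / ε) * ((1 - ε - (1 + ε) * Real.exp (ε * (w + z))) /
    (1 - ε + (1 + ε) * Real.exp (ε * (w + z))))

/-- The coefficient of `U_z` in the entropy equation `U_wz + b (w+z) U_w + a (w+z) U_z = 0`. -/
def aBar (ε ξ : ℝ) : ℝ :=
  -((1 - ε ^ 2) / 4) * ((1 - ε + (1 + ε) * Real.exp (ε * ξ)) /
    (1 + ε + (1 - ε) * Real.exp (ε * ξ)))

/-- The coefficient of `U_w` in the entropy equation `U_wz + b (w+z) U_w + a (w+z) U_z = 0`. -/
def bBar (ε ξ : ℝ) : ℝ :=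
  ((1 - ε ^ 2) / 4) * ((1 + ε + (1 - ε) * Real.exp (ε * ξ)) /
    (1 - ε + (1 + ε) * Real.exp (ε * ξ)))

/-- `R x y w z` is the Riemann function `R(x, y; w, z)` of the entropy equation: for every pole
`(w, z)` the map `(x, y) ↦ R(x, y; w, z)` is a classical solution on the whole plane of the
Goursat problem for the adjoint equation. -/
structure IsRiemannFunction (ε : ℝ) (R : ℝ → ℝ → ℝ → ℝ → ℝ) : Prop where
  contDiff : ∀ w z, ContDiff ℝ 2 (fun p : ℝ × ℝ => R p.1 p.2 w z)
  adjoint_eq : ∀ w z x y,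
    deriv (fun y' => deriv (fun x' => R x' y' w z) x) y
      - deriv (fun x' => bBar ε (x' + y) * R x' y w z) x
      - deriv (fun y' => aBar ε (x + y') * R x y' w z) y = 0
  on_line_z : ∀ w z x, deriv (fun x' => R x' z w z) x = aBar ε (x + z) * R x z w z
  on_line_w : ∀ w z y, deriv (fun y' => R w y' w z) y = bBar ε (w + y) * R w y w z
  at_pole : ∀ w z, R w z w z = 1

/-- The entropy kernel: `R(0, 0; w, z)` where `w z ≤ 0`, and `0` where `w z > 0`. -/
def entropyKernel (R : ℝ → ℝ → ℝ → ℝ → ℝ) (p : ℝ × ℝ) : ℝ :=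
  open Classical in if p.1 * p.2 ≤ 0 then R 0 0 p.1 p.2 else 0

/-- The function `C₁(w, z) = ∂_w R(0, 0; w, z)`, the regular part of `χ_w` on `{w z < 0}`. -/
def C1 (R : ℝ → ℝ → ℝ → ℝ → ℝ) (p : ℝ × ℝ) : ℝ := deriv (fun w => R 0 0 w p.2) p.1

/-- The function `C₂(w, z) = ∂_z R(0, 0; w, z)`, the regular part of `χ_z` on `{w z < 0}`. -/
def C2 (R : ℝ → ℝ → ℝ → ℝ → ℝ) (p : ℝ × ℝ) : ℝ := deriv (fun z => R 0 0 p.1 z) p.2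

def C3 (ε : ℝ) (R : ℝ → ℝ → ℝ → ℝ → ℝ) (p : ℝ × ℝ) : ℝ :=
  (lam2 ε p.1 p.2 - (p.1 + p.2) / 2) * C1 R p - 1 / 2 * entropyKernel R p

def C4 (ε : ℝ) (R : ℝ → ℝ → ℝ → ℝ → ℝ) (p : ℝ × ℝ) : ℝ :=
  (lam1 ε p.1 p.2 - (p.1 + p.2) / 2) * C2 R p - 1 / 2 * entropyKernel R p

def C5 (ε z : ℝ) : ℝ :=
  |z| * ((1 - ε + (1 + ε) * Real.exp (ε * z)) / 4)
    + Real.sign z * ((1 - ε - (1 + ε) * Real.exp (ε * z)) / (2 * ε))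

def C6 (ε w : ℝ) : ℝ :=
  |w| * ((1 + ε + (1 - ε) * Real.exp (ε * w)) / 4)
    + Real.sign w * ((1 + ε - (1 - ε) * Real.exp (ε * w)) / (2 * ε))

/-- The union of the regions `ρ < 1` (where `w < z`) and `ρ > 1` (where `w > z`). -/
def nonunitDensity : Set (ℝ × ℝ) := {p | p.1 ≠ p.2}

/-- Smooth test functions with compact support in the open set `Ω`. -/
structure IsTestFunction (Ω : Set (ℝ × ℝ)) (φ : ℝ × ℝ → ℝ) : Prop where
  contDiff : ContDiff ℝ ∞ φ
  hasCompactSupport : HasCompactSupport φ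
  tsupport_subset : tsupport φ ⊆ Ω

/-- Partial derivative with respect to `w`. -/
def dw (φ : ℝ × ℝ → ℝ) (p : ℝ × ℝ) : ℝ := deriv (fun w => φ (w, p.2)) p.1

/-- Partial derivative with respect to `z`. -/
def dz (φ : ℝ × ℝ → ℝ) (p : ℝ × ℝ) : ℝ := deriv (fun z => φ (p.1, z)) p.2

/-- The modified flux kernel `σ♯ = σ - u χ`, where `u = (w + z) / 2` is `ubar(v)`. -/
def sharp (χ σ : ℝ × ℝ → ℝ) (p : ℝ × ℝ) : ℝ := σ p - (p.1 + p.2) / 2 * χ p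

/-- `σ` is an entropy flux kernel associated with the entropy kernel `χ`, normalised at the origin.
The two equations say that `σ_w = λ₂ χ_w` and `σ_z = λ₁ χ_z` in the sense of distributions in each
of the regions `ρ < 1` and `ρ > 1`; the value of `σ♯` at the origin is the limit from the inside
`{w z < 0}` of the support of `χ`. -/
structure IsEntropyFluxKernel (ε : ℝ) (χ σ : ℝ × ℝ → ℝ) : Prop where
  locallyIntegrableOn : LocallyIntegrableOn σ nonunitDensity
  eq_w : ∀ φ, IsTestFunction nonunitDensity φ →
    -∫ p, σ p * dw φ p = -∫ p, χ p * dw (fun q => lam2 ε q.1 q.2 * φ q) p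
  eq_z : ∀ φ, IsTestFunction nonunitDensity φ →
    -∫ p, σ p * dz φ p = -∫ p, χ p * dz (fun q => lam1 ε q.1 q.2 * φ q) p
  sharp_zero : Tendsto (sharp χ σ) (𝓝[{p : ℝ × ℝ | p.1 * p.2 < 0}] (0, 0)) (𝓝 0)

end

end RelEuler

namespace RelEuler

/-! The entropy equation `U_wz + b U_w + a U_z = 0` becomes explicitly solvable after rescaling its
first derivatives: with `U_w = (1 - ε + (1 + ε) e^{ε(w+z)}) P / (2(1 - ε))` and `U_z = (1 + ε + (1 -
ε) e^{ε(w+z)}) Q / (2(1 + ε))` it turns into `P_z = Q_w = α Q - β P` with the constants `α = (1 -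
ε)² / 4`, `β = (1 + ε)² / 4`. This is a telegraph system, solved by exponentials times Bessel
functions of `(w - x₀)(z - y₀)`, so every pole has a smooth global Goursat solution
(`exists_isGoursatSolution`).

Green's identity gives Riemann's reciprocity (`IsAdjointSolution.eq_goursat`): a solution `v` of the
adjoint problem with pole `(w, z)` and a Goursat solution `u` with pole `(x₀, y₀)` satisfy `v (x₀,
y₀) = u (w, z)`. Hence the Riemann function is unique and smooth in its pole. It exists because
multiplication by `λ₂ - λ₁` and exchange of the variables carry Goursat solutions to adjoint
solutions.

Let `u = R(0, 0; ·)`. Since `λ₁' = -a (λ₂ - λ₁)` and `λ₂' = b (λ₂ - λ₁)`, the form `λ₂ u_w dw + λ₁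
u_z dz` is closed; its primitive `F` with `F(0, 0) = 0` equals `λ₂ u - 1` on `w = 0` and `λ₁ u + 1`
on `z = 0`. The Rankine-Hugoniot conditions then force a flux kernel equal to `F` on `w z < 0` to be
`-1` across `w = 0` and `+1` across `z = 0`. The two constants meet on the diagonal `w = z`, and
this jump is why the equations are posed only off it. The traces of `F` give the coefficients of the
delta masses.

Two flux kernels differ by a function with zero weak gradient on each of two half planes, hence by a
constant there (`ae_const_of_weak_gradient_zero`); the limit at the origin makes both constants
zero. The formulas for `σ♯`, computed for one kernel, therefore hold for all. -/

/-! ### Bessel functions and the telegraph profile. -/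

/-- The power series `∑ t ^ n / (n! (n + k)!)` of the modified Bessel functions. -/
noncomputable def besselSeries (k : ℕ) (t : ℝ) : ℝ :=
  ∑' n : ℕ, t ^ n / (n.factorial * (n + k).factorial)

lemma summable_besselSeries (k : ℕ) (t : ℝ) :
    Summable fun n : ℕ => t ^ n / ((n.factorial : ℝ) * (n + k).factorial) := by
  refine Summable.of_norm_bounded (Real.summable_pow_div_factorial |t|) fun n => ?_
  have h1 : (1 : ℝ) ≤ (n + k).factorial := by exact_mod_cast Nat.succ_le_of_lt (Nat.factorial_pos _)
  have h2 : (0 : ℝ) < n.factorial := by exact_mod_cast Nat.factorial_pos _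
  rw [norm_div, norm_pow, Real.norm_eq_abs, Real.norm_of_nonneg (by positivity)]
  exact div_le_div_of_nonneg_left (by positivity) h2 (by nlinarith)

/-- Differentiation term by term: the `n = 0` term drops out, and a factor `n + 1` cancels from `(n
+ 1)!`, which raises the index `k` by one. -/
lemma hasDerivAt_besselSeries (k : ℕ) (t : ℝ) :
    HasDerivAt (besselSeries k) (besselSeries (k + 1) t) t := by
  have key := hasDerivAt_tsum_of_isPreconnected (𝕜 := ℝ) (F := ℝ)
    (g := fun (n : ℕ) (y : ℝ) => y ^ n / ((n.factorial : ℝ) * (n + k).factorial))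
    (g' := fun (n : ℕ) (y : ℝ) => n * y ^ (n - 1) / ((n.factorial : ℝ) * (n + k).factorial))
    -- A bound for the differentiated terms on the ball of radius `|t| + 1`, with `(n + k)!`
    -- estimated below by `1`.
    (u := fun n : ℕ => n * (|t| + 1) ^ (n - 1) / (n.factorial : ℝ))
    (t := Metric.ball 0 (|t| + 1)) (y₀ := 0) (y := t) ?_ Metric.isOpen_ball
    (convex_ball _ _).isPreconnected ?_ ?_ (by simp; positivity)
    (summable_besselSeries k 0) (by simp)
  · refine key.congr_deriv ?_
    rw [Summable.tsum_eq_zero_add]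
    · simp only [besselSeries, Nat.cast_zero, zero_mul, zero_div, zero_add]
      refine tsum_congr fun n => ?_
      have h2 : (n.factorial : ℝ) ≠ 0 := by exact_mod_cast (Nat.factorial_pos _).ne'
      have h3 : ((n + 1 + k).factorial : ℝ) ≠ 0 := by exact_mod_cast (Nat.factorial_pos _).ne'
      rw [show n + (k + 1) = n + 1 + k by ring, Nat.factorial_succ n]
      push_cast
      have : (n : ℝ) + 1 ≠ 0 := by positivity
      field_simp
    · refine (summable_nat_add_iff 1).1 ?_
      refine (summable_besselSeries (k + 1) t).congr fun n => ?_
      have h2 : (n.factorial : ℝ) ≠ 0 := by exact_mod_cast (Nat.factorial_pos _).ne'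
      have h3 : ((n + 1 + k).factorial : ℝ) ≠ 0 := by exact_mod_cast (Nat.factorial_pos _).ne'
      rw [show n + (k + 1) = n + 1 + k by ring, Nat.factorial_succ n]
      push_cast
      have : (n : ℝ) + 1 ≠ 0 := by positivity
      field_simp
  · refine (summable_nat_add_iff 1).1 ?_
    refine (Real.summable_pow_div_factorial (|t| + 1)).congr fun n => ?_
    have h2 : (n.factorial : ℝ) ≠ 0 := by exact_mod_cast (Nat.factorial_pos _).ne'
    rw [Nat.factorial_succ n]
    push_cast
    have : (n : ℝ) + 1 ≠ 0 := by positivity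
    field_simp
  · intro n y _
    exact ((hasDerivAt_pow n y).div_const _)
  · intro n y hy
    have hy' : |y| ≤ |t| + 1 := by
      have := mem_ball_zero_iff.1 hy
      rw [Real.norm_eq_abs] at this
      exact this.le
    have h1 : (1 : ℝ) ≤ (n + k).factorial := by
      exact_mod_cast Nat.succ_le_of_lt (Nat.factorial_pos _)
    have h2 : (0 : ℝ) < n.factorial := by exact_mod_cast Nat.factorial_pos _
    rw [norm_div, norm_mul, norm_pow, Real.norm_eq_abs y, Real.norm_of_nonneg (by positivity),
      Real.norm_of_nonneg (by positivity)]
    calc _ ≤ n * |y| ^ (n - 1) / (n.factorial : ℝ) :=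
          div_le_div_of_nonneg_left (by positivity) h2 (by nlinarith)
      _ ≤ _ := by gcongr

lemma contDiff_besselSeries (k : ℕ) : ContDiff ℝ ∞ (besselSeries k) := by
  rw [contDiff_infty]
  intro n
  induction n generalizing k with
  | zero =>
    exact contDiff_zero.2 (continuous_iff_continuousAt.2
      fun t => (hasDerivAt_besselSeries k t).continuousAt)
  | succ n ih =>
    push_cast
    rw [contDiff_succ_iff_deriv]
    refine ⟨fun t => (hasDerivAt_besselSeries k t).differentiableAt, by simp, ?_⟩
    rw [show deriv (besselSeries k) = besselSeries (k + 1) from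
      funext fun t => (hasDerivAt_besselSeries k t).deriv]
    exact ih (k + 1)

lemma besselSeries_zero_apply_zero : besselSeries 0 0 = 1 := by
  rw [besselSeries, tsum_eq_single 0]
  · simp
  · intro n hn; simp [hn]

/-- This is Bessel's equation `t y'' + y' = y`; on coefficients, `1 / (n! (n+2)!) + 1 / ((n+1)!
(n+2)!) = 1 / ((n+1)!)²`. -/
lemma besselSeries_ode (t : ℝ) :
    t * besselSeries 2 t + besselSeries 1 t = besselSeries 0 t := by
  simp only [besselSeries]
  rw [(summable_besselSeries 1 t).tsum_eq_zero_add, (summable_besselSeries 0 t).tsum_eq_zero_add,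
    ← tsum_mul_left, add_left_comm, ← Summable.tsum_add]
  · congr 1
    refine tsum_congr fun n => ?_
    have h2 : (n.factorial : ℝ) ≠ 0 := by exact_mod_cast (Nat.factorial_pos _).ne'
    rw [show n + 1 + 1 = n + 2 by ring, show n + 1 + 0 = n + 1 by ring,
      Nat.factorial_succ (n + 1), Nat.factorial_succ n]
    push_cast
    have : (n : ℝ) + 1 ≠ 0 := by positivity
    have : (n : ℝ) + 1 + 1 ≠ 0 := by positivity
    field_simp
    ring
  · exact (summable_besselSeries 2 t).mul_left t
  · exact (summable_nat_add_iff 1).2 (summable_besselSeries 1 t)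

/-- The radial profile of the Riemann function of `V_wz + c V = 0`. -/
lemma exists_telegraph_profile (c : ℝ) : ∃ f f₁ f₂ : ℝ → ℝ, ContDiff ℝ ∞ f ∧ ContDiff ℝ ∞ f₁ ∧
    f 0 = 1 ∧ (∀ t, HasDerivAt f (f₁ t) t) ∧ (∀ t, HasDerivAt f₁ (f₂ t) t) ∧
    ∀ t, t * f₂ t + f₁ t = -c * f t := by
  have h (k : ℕ) (t : ℝ) : HasDerivAt (fun t => besselSeries k (-c * t))
      (besselSeries (k + 1) (-c * t) * -c) t := by
    have := (hasDerivAt_besselSeries k (-c * t)).comp t ((hasDerivAt_id t).const_mul (-c))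
    simpa [Function.comp_def] using this
  refine ⟨fun t => besselSeries 0 (-c * t), fun t => besselSeries 1 (-c * t) * -c,
    fun t => besselSeries 2 (-c * t) * -c * -c, ?_, ?_, ?_, h 0, fun t => (h 1 t).mul_const _, ?_⟩
  · exact (contDiff_besselSeries 0).comp (by fun_prop)
  · exact ((contDiff_besselSeries 1).comp (by fun_prop)).mul contDiff_const
  · simp [besselSeries_zero_apply_zero]
  · intro t
    have := besselSeries_ode (-c * t)
    linear_combination -c * this

/-! ### Functions of two variables with prescribed gradient. -/

/-- `G` is totally differentiable with partial derivatives `p` and `q`. -/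
def HasPartials (G p q : ℝ × ℝ → ℝ) : Prop :=
  ∀ x, HasFDerivAt G (p x • ContinuousLinearMap.fst ℝ ℝ ℝ + q x • ContinuousLinearMap.snd ℝ ℝ ℝ) x

namespace HasPartials

variable {G p q : ℝ × ℝ → ℝ}

lemma hasDerivAt_fst (h : HasPartials G p q) (w z : ℝ) :
    HasDerivAt (fun w => G (w, z)) (p (w, z)) w := by
  have := (h (w, z)).comp_hasDerivAt w ((hasDerivAt_id w).prodMk (hasDerivAt_const w z))
  simpa [Function.comp_def] using this

lemma hasDerivAt_snd (h : HasPartials G p q) (w z : ℝ) :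
    HasDerivAt (fun z => G (w, z)) (q (w, z)) z := by
  have := (h (w, z)).comp_hasDerivAt z ((hasDerivAt_const z w).prodMk (hasDerivAt_id z))
  simpa [Function.comp_def] using this

lemma differentiable (h : HasPartials G p q) : Differentiable ℝ G := fun x => (h x).differentiableAt

lemma contDiff (h : HasPartials G p q) (hp : ContDiff ℝ ∞ p) (hq : ContDiff ℝ ∞ q) :
    ContDiff ℝ ∞ G := by
  rw [contDiff_infty_iff_fderiv]
  refine ⟨h.differentiable, ?_⟩
  rw [show fderiv ℝ G = fun x => p x • ContinuousLinearMap.fst ℝ ℝ ℝ +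
    q x • ContinuousLinearMap.snd ℝ ℝ ℝ from funext fun x => (h x).fderiv]
  exact (hp.smul contDiff_const).add (hq.smul contDiff_const)

lemma add_const (h : HasPartials G p q) (k : ℝ) : HasPartials (fun x => G x + k) p q :=
  fun x => (h x).add_const k

end HasPartials

lemma _root_.Differentiable.hasPartials {G : ℝ × ℝ → ℝ} (h : Differentiable ℝ G) :
    HasPartials G (dw G) (dz G) := by
  intro x
  have hx := (h x).hasFDerivAt
  have h1 : dw G x = fderiv ℝ G x (1, 0) := by
    have := hx.comp_hasDerivAt x.1 ((hasDerivAt_id x.1).prodMk (hasDerivAt_const x.1 x.2))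
    exact this.deriv
  have h2 : dz G x = fderiv ℝ G x (0, 1) := by
    have := hx.comp_hasDerivAt x.2 ((hasDerivAt_const x.2 x.1).prodMk (hasDerivAt_id x.2))
    exact this.deriv
  convert hx using 1
  ext <;> simp [h1, h2]

/-- Poincaré lemma in the plane. -/
lemma exists_hasPartials {p q : ℝ × ℝ → ℝ} (hp : Differentiable ℝ p) (hq : Differentiable ℝ q)
    (h : ∀ x, dz p x = dw q x) : ∃ G, HasPartials G p q := by
  have hω (x : ℝ × ℝ) : HasFDerivAt (fun x => p x • ContinuousLinearMap.fst ℝ ℝ ℝ +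
      q x • ContinuousLinearMap.snd ℝ ℝ ℝ) _ x :=
    ((hp.hasPartials x).smul_const (ContinuousLinearMap.fst ℝ ℝ ℝ)).add
    ((hq.hasPartials x).smul_const (ContinuousLinearMap.snd ℝ ℝ ℝ))
  obtain ⟨G, hG⟩ := (convex_univ (𝕜 := ℝ) (E := ℝ × ℝ)).exists_forall_hasFDerivAt_of_fderiv_symmetric
    isOpen_univ (fun x _ => (hω x).differentiableAt.differentiableWithinAt) (fun x _ u v => by
      rw [(hω x).fderiv]
      simp [h x]
      ring)
  exact ⟨G, fun x => hG x trivial⟩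

/-! ### Derivatives of the characteristic speeds. -/

/-- Differences `λ₂ - λ₁` of the characteristic speeds. -/
noncomputable def speedGap (ε ξ : ℝ) : ℝ :=
  8 * Real.exp (ε * ξ) /
    ((1 + ε + (1 - ε) * Real.exp (ε * ξ)) * (1 - ε + (1 + ε) * Real.exp (ε * ξ)))

lemma denom1_pos {ε : ℝ} (h0 : 0 < ε) (h1 : ε < 1) (t : ℝ) :
    0 < 1 + ε + (1 - ε) * Real.exp t := by
  have := Real.exp_pos t
  have : 0 < 1 - ε := by linarith
  positivity

lemma denom2_pos {ε : ℝ} (h0 : 0 < ε) (h1 : ε < 1) (t : ℝ) :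
    0 < 1 - ε + (1 + ε) * Real.exp t := by
  have := Real.exp_pos t
  have : 0 < 1 - ε := by linarith
  positivity

lemma contDiff_aBar {ε : ℝ} (h0 : 0 < ε) (h1 : ε < 1) : ContDiff ℝ ∞ (aBar ε) := by
  unfold aBar
  exact contDiff_const.mul (ContDiff.div (by fun_prop) (by fun_prop)
    fun ξ => (denom1_pos h0 h1 (ε * ξ)).ne')

lemma contDiff_bBar {ε : ℝ} (h0 : 0 < ε) (h1 : ε < 1) : ContDiff ℝ ∞ (bBar ε) := by
  unfold bBar
  exact contDiff_const.mul (ContDiff.div (by fun_prop) (by fun_prop)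
    fun ξ => (denom2_pos h0 h1 (ε * ξ)).ne')

lemma contDiff_speedGap {ε : ℝ} (h0 : 0 < ε) (h1 : ε < 1) : ContDiff ℝ ∞ (speedGap ε) := by
  unfold speedGap
  exact ContDiff.div (by fun_prop) (by fun_prop)
    fun ξ => (mul_pos (denom1_pos h0 h1 (ε * ξ)) (denom2_pos h0 h1 (ε * ξ))).ne'

lemma speedGap_pos {ε : ℝ} (h0 : 0 < ε) (h1 : ε < 1) (ξ : ℝ) : 0 < speedGap ε ξ := by
  have := denom1_pos h0 h1 (ε * ξ)
  have := denom2_pos h0 h1 (ε * ξ)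
  unfold speedGap
  positivity

lemma hasDerivAt_exp_mul (ε ξ : ℝ) :
    HasDerivAt (fun ξ => Real.exp (ε * ξ)) (ε * Real.exp (ε * ξ)) ξ := by
  have := ((hasDerivAt_id ξ).const_mul ε).exp
  simpa [mul_comm] using this

/-- The logarithmic derivative `a + b` makes `λ₂ - λ₁` the factor that conjugates the entropy
equation to its adjoint. -/
lemma hasDerivAt_speedGap {ε : ℝ} (h0 : 0 < ε) (h1 : ε < 1) (ξ : ℝ) :
    HasDerivAt (speedGap ε) ((aBar ε ξ + bBar ε ξ) * speedGap ε ξ) ξ := by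
  have hE := hasDerivAt_exp_mul ε ξ
  have d1 := denom1_pos h0 h1 (ε * ξ)
  have d2 := denom2_pos h0 h1 (ε * ξ)
  have := (hE.const_mul 8).div (((hE.const_mul (1 - ε)).const_add (1 + ε)).mul
    ((hE.const_mul (1 + ε)).const_add (1 - ε))) (mul_pos d1 d2).ne'
  refine this.congr_deriv ?_
  simp only [Pi.mul_apply, aBar, bBar, speedGap]
  field_simp
  ring

/-- Together with `hasDerivAt_lam2` this is the compatibility of `σ_w = λ₂ u_w` and `σ_z = λ₁ u_z`
for solutions `u` of the entropy equation. -/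
lemma hasDerivAt_lam1 {ε : ℝ} (h0 : 0 < ε) (h1 : ε < 1) (ξ : ℝ) :
    HasDerivAt (lam1 ε 0) (-aBar ε ξ * speedGap ε ξ) ξ := by
  have hE := hasDerivAt_exp_mul ε ξ
  have d1 := denom1_pos h0 h1 (ε * ξ)
  have d2 := denom2_pos h0 h1 (ε * ξ)
  have := (((hE.const_mul (1 - ε)).const_sub (1 + ε)).div
    ((hE.const_mul (1 - ε)).const_add (1 + ε)) d1.ne').const_mul (-(1 / ε))
  unfold lam1
  simp only [zero_add]
  refine this.congr_deriv ?_
  have e1 := d1.ne'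
  have e2 := d2.ne'
  simp only [aBar, speedGap]
  generalize 1 - ε + (1 + ε) * Real.exp (ε * ξ) = Q at e2 ⊢
  field_simp
  ring

lemma hasDerivAt_lam2 {ε : ℝ} (h0 : 0 < ε) (h1 : ε < 1) (ξ : ℝ) :
    HasDerivAt (lam2 ε 0) (bBar ε ξ * speedGap ε ξ) ξ := by
  have hE := hasDerivAt_exp_mul ε ξ
  have d1 := denom1_pos h0 h1 (ε * ξ)
  have d2 := denom2_pos h0 h1 (ε * ξ)
  have := (((hE.const_mul (1 + ε)).const_sub (1 - ε)).div
    ((hE.const_mul (1 + ε)).const_add (1 - ε)) d2.ne').const_mul (-(1 / ε))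
  unfold lam2
  simp only [zero_add]
  refine this.congr_deriv ?_
  have e1 := d1.ne'
  have e2 := d2.ne'
  simp only [bBar, speedGap]
  generalize 1 + ε + (1 - ε) * Real.exp (ε * ξ) = Q at e1 ⊢
  field_simp
  ring

lemma lam2_sub_lam1 {ε : ℝ} (h0 : 0 < ε) (h1 : ε < 1) (ξ : ℝ) :
    lam2 ε 0 ξ - lam1 ε 0 ξ = speedGap ε ξ := by
  have d1 := denom1_pos h0 h1 (ε * ξ)
  have d2 := denom2_pos h0 h1 (ε * ξ)
  unfold lam1 lam2 speedGap
  simp only [zero_add]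
  field_simp
  ring

lemma lam1_eq (ε w z : ℝ) : lam1 ε w z = lam1 ε 0 (w + z) := by simp [lam1]

lemma lam2_eq (ε w z : ℝ) : lam2 ε w z = lam2 ε 0 (w + z) := by simp [lam2]

/-! ### The Goursat problem for the entropy equation. -/

/-- Smooth solutions of a first order telegraph system with data on a pair of characteristics. -/
lemma exists_telegraph_system (α β x₀ y₀ m₁ m₂ : ℝ) : ∃ P Q : ℝ × ℝ → ℝ,
    ContDiff ℝ ∞ P ∧ ContDiff ℝ ∞ Q ∧
    (∀ w z, HasDerivAt (fun z => P (w, z)) (α * Q (w, z) - β * P (w, z)) z) ∧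
    (∀ w z, HasDerivAt (fun w => Q (w, z)) (α * Q (w, z) - β * P (w, z)) w) ∧
    (∀ w, P (w, y₀) = α * m₁ * Real.exp (α * (w - x₀))) ∧
    ∀ z, Q (x₀, z) = -(β * m₂ * Real.exp (-β * (z - y₀))) := by
  obtain ⟨f, f₁, f₂, hf, hf₁, f0, hdf, hdf₁, hode⟩ := exists_telegraph_profile (α * β)
  -- The exponential absorbs the term `-β P` of the first equation and `α Q` of the second. What
  -- remains are functions of `t = (w - x₀)(z - y₀)`, matched by `t f'' + f' = -α β f`; on the two
  -- lines `t = 0` and `f 0 = 1`.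
  refine ⟨fun x => Real.exp (α * (x.1 - x₀) - β * (x.2 - y₀)) *
      (m₁ * α * f ((x.1 - x₀) * (x.2 - y₀)) + m₂ * (x.2 - y₀) * f₁ ((x.1 - x₀) * (x.2 - y₀))),
    fun x => Real.exp (α * (x.1 - x₀) - β * (x.2 - y₀)) *
      (-m₂ * β * f ((x.1 - x₀) * (x.2 - y₀)) + m₁ * (x.1 - x₀) * f₁ ((x.1 - x₀) * (x.2 - y₀))),
    by fun_prop, by fun_prop, ?_, ?_, ?_, ?_⟩
  · intro w z
    have hz : HasDerivAt (fun z => z - y₀) 1 z := (hasDerivAt_id z).sub_const y₀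
    have ht := hz.const_mul (w - x₀)
    have hX := ((hz.const_mul β).const_sub (α * (w - x₀))).exp
    have h1 := (hdf ((w - x₀) * (z - y₀))).comp z ht
    have h2 := (hdf₁ ((w - x₀) * (z - y₀))).comp z ht
    refine (hX.mul ((h1.const_mul (m₁ * α)).add ((hz.const_mul m₂).mul h2))).congr_deriv ?_
    simp only [Pi.add_apply, Pi.mul_apply, Function.comp_apply]
    have := hode ((w - x₀) * (z - y₀))
    linear_combination Real.exp (α * (w - x₀) - β * (z - y₀)) * m₂ * this
  · intro w z
    have hz : HasDerivAt (fun w => w - x₀) 1 w := (hasDerivAt_id w).sub_const x₀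
    have ht := hz.mul_const (z - y₀)
    have hX := ((hz.const_mul α).sub_const (β * (z - y₀))).exp
    have h1 := (hdf ((w - x₀) * (z - y₀))).comp w ht
    have h2 := (hdf₁ ((w - x₀) * (z - y₀))).comp w ht
    refine (hX.mul ((h1.const_mul (-m₂ * β)).add ((hz.const_mul m₁).mul h2))).congr_deriv ?_
    simp only [Pi.add_apply, Pi.mul_apply, Function.comp_apply]
    have := hode ((w - x₀) * (z - y₀))
    linear_combination Real.exp (α * (w - x₀) - β * (z - y₀)) * m₁ * this
  · intro w
    simp [f0]
    ring
  · intro z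
    simp [f0]
    ring

/-- `u`, with partial derivatives `p` and `q`, is the solution of the entropy equation with the
characteristic data of the Riemann function on the lines through `(x₀, y₀)`. -/
structure IsGoursatSolution (ε x₀ y₀ : ℝ) (u p q : ℝ × ℝ → ℝ) : Prop where
  contDiff_fst : ContDiff ℝ ∞ p
  contDiff_snd : ContDiff ℝ ∞ q
  hasPartials : HasPartials u p q
  eq_fst : ∀ w z, HasDerivAt (fun z => p (w, z))
    (-(bBar ε (w + z) * p (w, z) + aBar ε (w + z) * q (w, z))) z
  eq_snd : ∀ w z, HasDerivAt (fun w => q (w, z))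
    (-(bBar ε (w + z) * p (w, z) + aBar ε (w + z) * q (w, z))) w
  on_line_z : ∀ w, u (w, y₀) = Real.exp ((1 - ε) ^ 2 / 4 * (w - x₀)) *
    (1 + ε + (1 - ε) * Real.exp (ε * (w + y₀))) / (1 + ε + (1 - ε) * Real.exp (ε * (x₀ + y₀)))
  on_line_w : ∀ z, u (x₀, z) = Real.exp (-((1 + ε) ^ 2 / 4) * (z - y₀)) *
    (1 - ε + (1 + ε) * Real.exp (ε * (x₀ + z))) / (1 - ε + (1 + ε) * Real.exp (ε * (x₀ + y₀)))

lemma eq_of_hasDerivAt_eq {f g f' : ℝ → ℝ} {a : ℝ} (hf : ∀ x, HasDerivAt f (f' x) x)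
    (hg : ∀ x, HasDerivAt g (f' x) x) (ha : f a = g a) (x : ℝ) : f x = g x := by
  have h := is_const_of_deriv_eq_zero (f := fun x => f x - g x)
    (fun x => ((hf x).sub (hg x)).differentiableAt)
    (fun x => ((hf x).sub (hg x)).deriv.trans (sub_self _)) x a
  simp only [ha, sub_self] at h
  linarith

/-- The weights in front of `P` and `Q` remove the variable coefficients, and equality of the mixed
derivatives allows `p dw + q dz` to be integrated. -/
lemma exists_isGoursatSolution {ε : ℝ} (h0 : 0 < ε) (h1 : ε < 1) (x₀ y₀ : ℝ) :
    ∃ u p q, IsGoursatSolution ε x₀ y₀ u p q := by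
  have dA (t : ℝ) := denom1_pos h0 h1 t
  have dB (t : ℝ) := denom2_pos h0 h1 t
  have hA : 0 < 1 - ε := by linarith
  have hB : 0 < 1 + ε := by linarith
  -- The factors `m₁`, `m₂` are those for which `p` on `z = y₀` and `q` on `w = x₀` are the
  -- derivatives of the prescribed boundary values.
  obtain ⟨P, Q, hP, hQ, hPz, hQw, hPl, hQl⟩ := exists_telegraph_system ((1 - ε) ^ 2 / 4)
    ((1 + ε) ^ 2 / 4) x₀ y₀ (2 * (1 + ε) / (1 + ε + (1 - ε) * Real.exp (ε * (x₀ + y₀))))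
    (2 * (1 - ε) / (1 - ε + (1 + ε) * Real.exp (ε * (x₀ + y₀))))
  set p : ℝ × ℝ → ℝ := fun x =>
    (1 - ε + (1 + ε) * Real.exp (ε * (x.1 + x.2))) / (2 * (1 - ε)) * P x with hp
  set q : ℝ × ℝ → ℝ := fun x =>
    (1 + ε + (1 - ε) * Real.exp (ε * (x.1 + x.2))) / (2 * (1 + ε)) * Q x with hq
  have cp : ContDiff ℝ ∞ p := by fun_prop
  have cq : ContDiff ℝ ∞ q := by fun_prop
  have eq_fst (w z : ℝ) : HasDerivAt (fun z => p (w, z))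
      (-(bBar ε (w + z) * p (w, z) + aBar ε (w + z) * q (w, z))) z := by
    have := (((((hasDerivAt_exp_mul ε (w + z)).comp_const_add w z).const_mul
      (1 + ε)).const_add (1 - ε)).div_const (2 * (1 - ε))).mul (hPz w z)
    refine this.congr_deriv ?_
    have := dA (ε * (w + z))
    have := dB (ε * (w + z))
    simp only [hp, hq, aBar, bBar]
    field_simp
    ring
  have eq_snd (w z : ℝ) : HasDerivAt (fun w => q (w, z))
      (-(bBar ε (w + z) * p (w, z) + aBar ε (w + z) * q (w, z))) w := by
    have := (((((hasDerivAt_exp_mul ε (w + z)).comp_add_const w z).const_mul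
      (1 - ε)).const_add (1 + ε)).div_const (2 * (1 + ε))).mul (hQw w z)
    refine this.congr_deriv ?_
    have := dA (ε * (w + z))
    have := dB (ε * (w + z))
    simp only [hp, hq, aBar, bBar]
    field_simp
    ring
  obtain ⟨u', hu'⟩ := exists_hasPartials (cp.differentiable (by simp)) (cq.differentiable (by simp))
    (fun x => (eq_fst x.1 x.2).deriv.trans (eq_snd x.1 x.2).deriv.symm)
  have hu := hu'.add_const (1 - u' (x₀, y₀))
  refine ⟨_, p, q, cp, cq, hu, eq_fst, eq_snd, ?_, ?_⟩
  · refine eq_of_hasDerivAt_eq (a := x₀) (fun w => hu.hasDerivAt_fst w y₀) (fun w => ?_) ?_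
    · have := ((((hasDerivAt_id w).sub_const x₀).const_mul ((1 - ε) ^ 2 / 4)).exp.mul
        ((((hasDerivAt_exp_mul ε (w + y₀)).comp_add_const w y₀).const_mul
        (1 - ε)).const_add (1 + ε))).div_const (1 + ε + (1 - ε) * Real.exp (ε * (x₀ + y₀)))
      refine this.congr_deriv ?_
      have := dA (ε * (x₀ + y₀))
      simp only [hp, hPl, id]
      field_simp
      ring
    · have := dA (ε * (x₀ + y₀))
      simp
      field_simp
  · refine eq_of_hasDerivAt_eq (a := y₀) (fun z => hu.hasDerivAt_snd x₀ z) (fun z => ?_) ?_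
    · have := ((((hasDerivAt_id z).sub_const y₀).const_mul (-((1 + ε) ^ 2 / 4))).exp.mul
        ((((hasDerivAt_exp_mul ε (x₀ + z)).comp_const_add x₀ z).const_mul
        (1 + ε)).const_add (1 - ε))).div_const (1 - ε + (1 + ε) * Real.exp (ε * (x₀ + y₀)))
      refine this.congr_deriv ?_
      have := dB (ε * (x₀ + y₀))
      simp only [hq, hQl, id]
      field_simp
      ring
    · have := dB (ε * (x₀ + y₀))
      simp
      field_simp

namespace IsGoursatSolution

variable {ε x₀ y₀ : ℝ} {u p q : ℝ × ℝ → ℝ}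

lemma contDiff (h : IsGoursatSolution ε x₀ y₀ u p q) : ContDiff ℝ ∞ u :=
  h.hasPartials.contDiff h.contDiff_fst h.contDiff_snd

/-- The boundary value was chosen to have logarithmic derivative `-a`. -/
lemma fst_on_line_z (h : IsGoursatSolution ε x₀ y₀ u p q) (h0 : 0 < ε) (h1 : ε < 1) (w : ℝ) :
    p (w, y₀) = -aBar ε (w + y₀) * u (w, y₀) := by
  have := ((((hasDerivAt_id w).sub_const x₀).const_mul ((1 - ε) ^ 2 / 4)).exp.mul
    ((((hasDerivAt_exp_mul ε (w + y₀)).comp_add_const w y₀).const_mul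
    (1 - ε)).const_add (1 + ε))).div_const (1 + ε + (1 - ε) * Real.exp (ε * (x₀ + y₀)))
  have hd := h.hasPartials.hasDerivAt_fst w y₀
  rw [show (fun w => u (w, y₀)) = _ from funext h.on_line_z] at hd
  rw [hd.unique this, h.on_line_z]
  have := denom1_pos h0 h1 (ε * (x₀ + y₀))
  have := denom1_pos h0 h1 (ε * (w + y₀))
  simp only [aBar, id]
  field_simp
  ring

lemma snd_on_line_w (h : IsGoursatSolution ε x₀ y₀ u p q) (h0 : 0 < ε) (h1 : ε < 1) (z : ℝ) :
    q (x₀, z) = -bBar ε (x₀ + z) * u (x₀, z) := by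
  have := ((((hasDerivAt_id z).sub_const y₀).const_mul (-((1 + ε) ^ 2 / 4))).exp.mul
    ((((hasDerivAt_exp_mul ε (x₀ + z)).comp_const_add x₀ z).const_mul
    (1 + ε)).const_add (1 - ε))).div_const (1 - ε + (1 + ε) * Real.exp (ε * (x₀ + y₀)))
  have hd := h.hasPartials.hasDerivAt_snd x₀ z
  rw [show (fun z => u (x₀, z)) = _ from funext h.on_line_w] at hd
  rw [hd.unique this, h.on_line_w]
  have := denom2_pos h0 h1 (ε * (x₀ + y₀))
  have := denom2_pos h0 h1 (ε * (x₀ + z))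
  simp only [bBar, id]
  field_simp
  ring

lemma at_pole (h : IsGoursatSolution ε x₀ y₀ u p q) (h0 : 0 < ε) (h1 : ε < 1) :
    u (x₀, y₀) = 1 := by
  have := denom1_pos h0 h1 (ε * (x₀ + y₀))
  rw [h.on_line_z]
  simp [this.ne']

end IsGoursatSolution

/-! ### The adjoint equation, reciprocity and the Riemann function. -/

lemma contDiff_dw {n : WithTop ℕ∞} {G : ℝ × ℝ → ℝ} (hG : ContDiff ℝ (n + 1) G) :
    ContDiff ℝ n (dw G) := by
  have hd : Differentiable ℝ G := hG.differentiable (by simp)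
  have : dw G = fun x => fderiv ℝ G x (1, 0) := by
    funext x
    simp [(hd.hasPartials x).fderiv]
  rw [this]
  exact (hG.fderiv_right le_rfl).clm_apply contDiff_const

/-- `v` solves the Goursat problem for the adjoint equation with pole `(w, z)`. -/
structure IsAdjointSolution (ε w z : ℝ) (v : ℝ × ℝ → ℝ) : Prop where
  contDiff : ContDiff ℝ 2 v
  adjoint_eq : ∀ x y, deriv (fun y' => deriv (fun x' => v (x', y')) x) y
      - deriv (fun x' => bBar ε (x' + y) * v (x', y)) x
      - deriv (fun y' => aBar ε (x + y') * v (x, y')) y = 0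
  on_line_z : ∀ x, deriv (fun x' => v (x', z)) x = aBar ε (x + z) * v (x, z)
  on_line_w : ∀ y, deriv (fun y' => v (w, y')) y = bBar ε (w + y) * v (w, y)
  at_pole : v (w, z) = 1

lemma isRiemannFunction_iff {ε : ℝ} {R : ℝ → ℝ → ℝ → ℝ → ℝ} :
    IsRiemannFunction ε R ↔ ∀ w z, IsAdjointSolution ε w z fun x => R x.1 x.2 w z :=
  ⟨fun h w z => ⟨h.contDiff w z, h.adjoint_eq w z, h.on_line_z w z, h.on_line_w w z,
    h.at_pole w z⟩, fun h => ⟨fun w z => (h w z).contDiff, fun w z => (h w z).adjoint_eq,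
    fun w z => (h w z).on_line_z, fun w z => (h w z).on_line_w, fun w z => (h w z).at_pole⟩⟩

lemma hasDerivAt_comp_add_const {g : ℝ → ℝ} (hg : Differentiable ℝ g) (w z : ℝ) :
    HasDerivAt (fun w => g (w + z)) (deriv g (w + z)) w :=
  (hg (w + z)).hasDerivAt.comp_add_const w z

lemma hasDerivAt_comp_const_add {g : ℝ → ℝ} (hg : Differentiable ℝ g) (w z : ℝ) :
    HasDerivAt (fun z => g (w + z)) (deriv g (w + z)) z :=
  (hg (w + z)).hasDerivAt.comp_const_add w z

/-- Riemann's reciprocity relation, from Green's identity. -/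
lemma IsAdjointSolution.eq_goursat {ε w z x₀ y₀ : ℝ} (h0 : 0 < ε) (h1 : ε < 1)
    {v u p q : ℝ × ℝ → ℝ} (hv : IsAdjointSolution ε w z v)
    (hu : IsGoursatSolution ε x₀ y₀ u p q) : v (x₀, y₀) = u (w, z) := by
  have da : Differentiable ℝ (aBar ε) := (contDiff_aBar h0 h1).differentiable (by simp)
  have db : Differentiable ℝ (bBar ε) := (contDiff_bBar h0 h1).differentiable (by simp)
  have dv : Differentiable ℝ v := hv.contDiff.differentiable (by simp)
  have dvw : Differentiable ℝ (dw v) :=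
    (contDiff_dw (n := 1) (by rw [one_add_one_eq_two]; exact hv.contDiff)).differentiable (by simp)
  have vp := dv.hasPartials
  have vwp := dvw.hasPartials
  have du : Differentiable ℝ u := hu.hasPartials.differentiable
  have dq : Differentiable ℝ q := hu.contDiff_snd.differentiable (by simp)
  -- The form `P dw + Q dz` is closed by the two equations. It vanishes along the sides `w = x₀`
  -- and, by the data of `v`, `z = const` through the pole of `v`; along the other two sides of the
  -- rectangle it equals `-d(u v)`. Comparing both paths from `(x₀, y₀)` to `(w, z)` gives the
  -- relation.
  set P : ℝ × ℝ → ℝ := fun x => u x * (aBar ε (x.1 + x.2) * v x - dw v x) with hP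
  set Q : ℝ × ℝ → ℝ := fun x => -(v x * (q x + bBar ε (x.1 + x.2) * u x)) with hQ
  obtain ⟨G, hG⟩ := exists_hasPartials (p := P) (q := Q) (by fun_prop) (by fun_prop) (by
    rintro ⟨s, t⟩
    have hPt := (hu.hasPartials.hasDerivAt_snd s t).mul
      (((hasDerivAt_comp_const_add da s t).mul (vp.hasDerivAt_snd s t)).sub
        (vwp.hasDerivAt_snd s t))
    have hQs := ((vp.hasDerivAt_fst s t).mul ((hu.eq_snd s t).add
      ((hasDerivAt_comp_add_const db s t).mul (hu.hasPartials.hasDerivAt_fst s t)))).neg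
    have hb := ((hasDerivAt_comp_add_const db s t).mul (vp.hasDerivAt_fst s t)).deriv
    have ha := ((hasDerivAt_comp_const_add da s t).mul (vp.hasDerivAt_snd s t)).deriv
    have hadj : dz (dw v) (s, t) - _ - _ = 0 := hv.adjoint_eq s t
    refine hPt.deriv.trans (Eq.trans ?_ hQs.deriv.symm)
    erw [hb, ha] at hadj
    simp only [Pi.add_apply, Pi.mul_apply, Pi.sub_apply]
    linear_combination -u (s, t) * hadj)
  have hP0 (s : ℝ) : P (s, z) = 0 := by
    have : dw v (s, z) = aBar ε (s + z) * v (s, z) := hv.on_line_z s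
    simp [hP, this]
  have hQ0 (t : ℝ) : Q (x₀, t) = 0 := by
    simp [hQ, hu.snd_on_line_w h0 h1 t]
  have e1 : G (w, z) = G (x₀, z) := eq_of_hasDerivAt_eq (f' := fun s => P (s, z)) (a := x₀)
    (fun s => hG.hasDerivAt_fst s z)
    (fun s => by rw [hP0]; exact hasDerivAt_const s (G (x₀, z))) rfl w
  have e2 : G (x₀, z) = G (x₀, y₀) := eq_of_hasDerivAt_eq (f' := fun t => Q (x₀, t)) (a := y₀)
    (fun t => hG.hasDerivAt_snd x₀ t)
    (fun t => by rw [hQ0]; exact hasDerivAt_const t (G (x₀, y₀))) rfl z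
  have e3 : G (w, y₀) + u (w, y₀) * v (w, y₀) = G (x₀, y₀) + u (x₀, y₀) * v (x₀, y₀) := by
    refine eq_of_hasDerivAt_eq (f := fun s => G (s, y₀) + u (s, y₀) * v (s, y₀))
      (g := fun _ => G (x₀, y₀) + u (x₀, y₀) * v (x₀, y₀)) (f' := fun _ => 0) (a := x₀)
      (fun s => ?_) (fun s => hasDerivAt_const s _) rfl w
    refine ((hG.hasDerivAt_fst s y₀).add ((hu.hasPartials.hasDerivAt_fst s y₀).mul
      (vp.hasDerivAt_fst s y₀))).congr_deriv ?_
    simp only [hP, hu.fst_on_line_z h0 h1 s]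
    ring
  have e4 : G (w, z) + u (w, z) * v (w, z) = G (w, y₀) + u (w, y₀) * v (w, y₀) := by
    refine eq_of_hasDerivAt_eq (f := fun t => G (w, t) + u (w, t) * v (w, t))
      (g := fun _ => G (w, y₀) + u (w, y₀) * v (w, y₀)) (f' := fun _ => 0) (a := y₀)
      (fun t => ?_) (fun t => hasDerivAt_const t _) rfl z
    refine ((hG.hasDerivAt_snd w t).add ((hu.hasPartials.hasDerivAt_snd w t).mul
      (vp.hasDerivAt_snd w t))).congr_deriv ?_
    have : dz v (w, t) = bBar ε (w + t) * v (w, t) := hv.on_line_w t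
    simp only [hQ, this]
    ring
  rw [hv.at_pole] at e4
  rw [hu.at_pole h0 h1] at e3
  linarith

/-- The adjoint equation is conjugate to the entropy equation with the variables exchanged. -/
lemma IsGoursatSolution.isAdjointSolution {ε w z : ℝ} (h0 : 0 < ε) (h1 : ε < 1)
    {u p q : ℝ × ℝ → ℝ} (hu : IsGoursatSolution ε z w u p q) :
    IsAdjointSolution ε w z
      fun x => speedGap ε (x.1 + x.2) / speedGap ε (w + z) * u (x.2, x.1) := by
  have da : Differentiable ℝ (aBar ε) := (contDiff_aBar h0 h1).differentiable (by simp)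
  have db : Differentiable ℝ (bBar ε) := (contDiff_bBar h0 h1).differentiable (by simp)
  have hD := contDiff_speedGap h0 h1
  have hD0 := (speedGap_pos h0 h1 (w + z)).ne'
  have hx (x y : ℝ) : HasDerivAt
      (fun x => speedGap ε (x + y) / speedGap ε (w + z) * u (y, x))
      (speedGap ε (x + y) / speedGap ε (w + z) *
        ((aBar ε (x + y) + bBar ε (x + y)) * u (y, x) + q (y, x))) x :=
    ((((hasDerivAt_speedGap h0 h1 (x + y)).comp_add_const x y).div_const _).mul
      (hu.hasPartials.hasDerivAt_snd y x)).congr_deriv (by ring)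
  have hy (x y : ℝ) : HasDerivAt
      (fun y => speedGap ε (x + y) / speedGap ε (w + z) * u (y, x))
      (speedGap ε (x + y) / speedGap ε (w + z) *
        ((aBar ε (x + y) + bBar ε (x + y)) * u (y, x) + p (y, x))) y :=
    ((((hasDerivAt_speedGap h0 h1 (x + y)).comp_const_add x y).div_const _).mul
      (hu.hasPartials.hasDerivAt_fst y x)).congr_deriv (by ring)
  refine ⟨?_, fun x y => ?_, fun x => ?_, fun y => ?_, ?_⟩
  · have : ContDiff ℝ 2 u := by exact_mod_cast contDiff_infty.1 hu.contDiff 2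
    have : ContDiff ℝ 2 (speedGap ε) := by exact_mod_cast contDiff_infty.1 hD 2
    fun_prop
  · have hxy := ((((hasDerivAt_speedGap h0 h1 (x + y)).comp_const_add x y).div_const
      (speedGap ε (w + z))).mul ((((hasDerivAt_comp_const_add da x y).add
      (hasDerivAt_comp_const_add db x y)).mul (hu.hasPartials.hasDerivAt_fst y x)).add
      (hu.eq_snd y x))).deriv
    have hb := ((hasDerivAt_comp_add_const db x y).mul (hx x y)).deriv
    have ha := ((hasDerivAt_comp_const_add da x y).mul (hy x y)).deriv
    simp only [(hx _ _).deriv]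
    erw [hxy, hb, ha]
    simp only [Pi.add_apply, Pi.mul_apply, add_comm y x]
    ring
  · rw [(hx x z).deriv, hu.snd_on_line_w h0 h1, add_comm z x]
    ring
  · rw [(hy w y).deriv, hu.fst_on_line_z h0 h1, add_comm y w]
    ring
  · simp only
    rw [hu.at_pole h0 h1]
    field_simp

lemma IsRiemannFunction.eq_goursat {ε x y : ℝ} (h0 : 0 < ε) (h1 : ε < 1)
    {R : ℝ → ℝ → ℝ → ℝ → ℝ} (hR : IsRiemannFunction ε R) {u p q : ℝ × ℝ → ℝ}
    (hu : IsGoursatSolution ε x y u p q) (w z : ℝ) : R x y w z = u (w, z) :=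
  (isRiemannFunction_iff.1 hR w z).eq_goursat h0 h1 hu

/-- Reciprocity gives uniqueness directly, and it identifies the family of Goursat solutions, read
as a function of its pole, with the adjoint solution obtained by conjugation. -/
theorem existsUnique_isRiemannFunction {ε : ℝ} (h0 : 0 < ε) (h1 : ε < 1) :
    ∃! R, IsRiemannFunction ε R := by
  choose u p q hu using fun x y => exists_isGoursatSolution h0 h1 x y
  refine ⟨fun x y w z => u x y (w, z), isRiemannFunction_iff.2 fun w z => ?_, fun R hR => ?_⟩
  · have hv := (hu z w).isAdjointSolution h0 h1
    convert hv using 1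
    funext x
    exact (hv.eq_goursat h0 h1 (hu x.1 x.2)).symm
  · funext x y w z
    exact hR.eq_goursat h0 h1 (hu x y) w z

/-! ### The entropy flux of the smooth solution. -/

lemma contDiff_lam1 {ε : ℝ} (h0 : 0 < ε) (h1 : ε < 1) :
    ContDiff ℝ ∞ fun x : ℝ × ℝ => lam1 ε x.1 x.2 := by
  unfold lam1
  exact contDiff_const.mul (ContDiff.div (by fun_prop) (by fun_prop)
    fun x => (denom1_pos h0 h1 (ε * (x.1 + x.2))).ne')

lemma contDiff_lam2 {ε : ℝ} (h0 : 0 < ε) (h1 : ε < 1) :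
    ContDiff ℝ ∞ fun x : ℝ × ℝ => lam2 ε x.1 x.2 := by
  unfold lam2
  exact contDiff_const.mul (ContDiff.div (by fun_prop) (by fun_prop)
    fun x => (denom2_pos h0 h1 (ε * (x.1 + x.2))).ne')

/-- The flux of a Goursat solution with pole at the origin. -/
lemma IsGoursatSolution.exists_flux {ε : ℝ} (h0 : 0 < ε) (h1 : ε < 1) {u p q : ℝ × ℝ → ℝ}
    (hu : IsGoursatSolution ε 0 0 u p q) : ∃ F : ℝ × ℝ → ℝ, ContDiff ℝ ∞ F ∧
      HasPartials F (fun x => lam2 ε x.1 x.2 * p x) (fun x => lam1 ε x.1 x.2 * q x) ∧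
      (∀ w, F (w, 0) = lam1 ε w 0 * u (w, 0) + 1) ∧
      (∀ z, F (0, z) = lam2 ε 0 z * u (0, z) - 1) ∧ F (0, 0) = 0 := by
  have l1 := contDiff_lam1 h0 h1
  have l2 := contDiff_lam2 h0 h1
  have cp := l2.mul hu.contDiff_fst
  have cq := l1.mul hu.contDiff_snd
  have d1 (ξ : ℝ) := hasDerivAt_lam1 h0 h1 ξ
  have d2 (ξ : ℝ) := hasDerivAt_lam2 h0 h1 ξ
  obtain ⟨F', hF'⟩ := exists_hasPartials (cp.differentiable (by simp)) (cq.differentiable (by simp))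
    (by
      rintro ⟨w, z⟩
      have e1 := ((d2 (w + z)).comp_const_add w z).mul (hu.eq_fst w z)
      have e2 := ((d1 (w + z)).comp_add_const w z).mul (hu.eq_snd w z)
      simp only [dz, dw]
      simp only [lam1_eq ε _ z, lam2_eq ε w]
      refine e1.deriv.trans (Eq.trans ?_ e2.deriv.symm)
      rw [← lam2_sub_lam1 h0 h1]
      ring)
  have hF := hF'.add_const (- F' (0, 0))
  have hl1 : lam1 ε 0 0 = -1 := by
    simp only [lam1, add_zero, mul_zero, Real.exp_zero]; field_simp; ring
  have hl2 : lam2 ε 0 0 = 1 := by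
    simp only [lam2, add_zero, mul_zero, Real.exp_zero]; field_simp; ring
  refine ⟨_, hF.contDiff cp cq, hF, fun w => ?_, fun z => ?_, by simp⟩
  · refine eq_of_hasDerivAt_eq (f := fun w => F' (w, 0) + -F' (0, 0))
      (g := fun w => lam1 ε w 0 * u (w, 0) + 1) (a := 0)
      (fun w => hF.hasDerivAt_fst w 0) (fun w => ?_) ?_ w
    -- On `z = 0` one has `p = -a u`, so `(λ₁ u)_w = -a (λ₂ - λ₁) u + λ₁ p = λ₂ p`; the constant `1`
    -- compensates `λ₁ = -1` at the origin.
    · have := (((d1 (w + 0)).comp_add_const w 0).mul (hu.hasPartials.hasDerivAt_fst w 0)).add_const 1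
      simp only [lam1_eq ε _ 0]
      refine this.congr_deriv ?_
      simp only [hu.fst_on_line_z h0 h1 w, lam2_eq ε w 0]
      rw [← lam2_sub_lam1 h0 h1]
      ring
    · simp [hl1, hu.at_pole h0 h1]
  · refine eq_of_hasDerivAt_eq (f := fun z => F' (0, z) + -F' (0, 0))
      (g := fun z => lam2 ε 0 z * u (0, z) - 1) (a := 0)
      (fun z => hF.hasDerivAt_snd 0 z) (fun z => ?_) ?_ z
    · refine (((d2 z).mul (hu.hasPartials.hasDerivAt_snd 0 z)).sub_const 1).congr_deriv ?_
      simp only [hu.snd_on_line_w h0 h1 z, zero_add]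
      rw [← lam2_sub_lam1 h0 h1]
      ring
    · simp [hl2, hu.at_pole h0 h1]

/-! ### Integration by parts on the quadrants `w z < 0`. -/

lemma continuous_dw {K : ℝ × ℝ → ℝ} (hK : ContDiff ℝ 1 K) : Continuous (dw K) :=
  (contDiff_dw (n := 0) (by simpa using hK)).continuous

lemma hasCompactSupport_dw {K : ℝ × ℝ → ℝ} (hK : ContDiff ℝ 1 K) (hc : HasCompactSupport K) :
    HasCompactSupport (dw K) := by
  have : dw K = fun x => fderiv ℝ K x (1, 0) := by
    funext x
    simp [((hK.differentiable (by simp)).hasPartials x).fderiv]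
  rw [this]
  exact (hc.fderiv (𝕜 := ℝ)).comp_left (g := fun L : ℝ × ℝ →L[ℝ] ℝ => L (1, 0)) rfl

lemma integrable_dw {K : ℝ × ℝ → ℝ} (hK : ContDiff ℝ 1 K) (hc : HasCompactSupport K) :
    Integrable (dw K) :=
  (continuous_dw hK).integrable_of_hasCompactSupport (hasCompactSupport_dw hK hc)

lemma hasCompactSupport_slice {K : ℝ × ℝ → ℝ} (hc : HasCompactSupport K) (z : ℝ) :
    HasCompactSupport fun w => K (w, z) :=
  hc.comp_isClosedEmbedding (Isometry.isClosedEmbedding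
    (Isometry.of_dist_eq fun a b => by simp [Prod.dist_eq]))

lemma measurableSet_mul_neg : MeasurableSet {p : ℝ × ℝ | p.1 * p.2 < 0} :=
  measurableSet_lt (by fun_prop) (by fun_prop)

lemma measurableSet_mul_nonpos : MeasurableSet {p : ℝ × ℝ | p.1 * p.2 ≤ 0} :=
  measurableSet_le (by fun_prop) (by fun_prop)

lemma ae_mul_ne_zero : ∀ᵐ p : ℝ × ℝ, p.1 * p.2 ≠ 0 := by
  have h : volume (({0} : Set ℝ) ×ˢ (Set.univ : Set ℝ) ∪ (Set.univ : Set ℝ) ×ˢ ({0} : Set ℝ)) = 0 := by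
    rw [measure_union_null_iff]
    constructor <;> rw [Measure.volume_eq_prod, Measure.prod_prod] <;> simp
  refine measure_mono_null (fun p hp => ?_) h
  simpa [or_iff_not_imp_left] using hp

/-- Integration of a `w`-derivative over the quadrants `w z < 0`. -/
lemma setIntegral_dw {K : ℝ × ℝ → ℝ} (hK : ContDiff ℝ 1 K) (hc : HasCompactSupport K) :
    ∫ p in {p : ℝ × ℝ | p.1 * p.2 < 0}, dw K p = ∫ z, Real.sign z * K (0, z) := by
  rw [← integral_indicator measurableSet_mul_neg, Measure.volume_eq_prod, integral_prod_symm]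
  · congr 1
    funext z
    have hKz : ContDiff ℝ 1 fun w => K (w, z) := by fun_prop
    have hcz := hasCompactSupport_slice hc z
    rcases lt_trichotomy z 0 with hz | rfl | hz
    · have : (fun w => Set.indicator {p : ℝ × ℝ | p.1 * p.2 < 0} (dw K) (w, z)) =
          Set.indicator (Set.Ioi 0) (deriv fun w => K (w, z)) := by
        funext w
        simp only [Set.indicator, Set.mem_ofPred_eq, Set.mem_Ioi, mul_neg_iff, hz, hz.not_gt]
        simp [dw]
      rw [this, integral_indicator measurableSet_Ioi, hcz.integral_Ioi_deriv_eq hKz,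
        Real.sign_of_neg hz]
      simp
    · simp
    · have : (fun w => Set.indicator {p : ℝ × ℝ | p.1 * p.2 < 0} (dw K) (w, z)) =
          Set.indicator (Set.Iio 0) (deriv fun w => K (w, z)) := by
        funext w
        simp only [Set.indicator, Set.mem_ofPred_eq, Set.mem_Iio, mul_neg_iff, hz, hz.not_gt]
        simp [dw]
      rw [this, integral_indicator measurableSet_Iio, ← integral_Iic_eq_integral_Iio,
        hcz.integral_Iic_deriv_eq hKz, Real.sign_of_pos hz]
      simp
  · rw [← Measure.volume_eq_prod]
    exact (integrable_dw hK hc).indicator measurableSet_mul_neg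

lemma dw_mul {G φ : ℝ × ℝ → ℝ} (hG : ContDiff ℝ 1 G) (hφ : ContDiff ℝ 1 φ) (p : ℝ × ℝ) :
    dw (fun p => G p * φ p) p = dw G p * φ p + G p * dw φ p :=
  (((hG.differentiable (by simp)).hasPartials.hasDerivAt_fst p.1 p.2).mul
    ((hφ.differentiable (by simp)).hasPartials.hasDerivAt_fst p.1 p.2)).deriv

/-- The distributional `w`-derivative of a function that vanishes outside `w z ≤ 0`. -/
lemma integral_indicator_mul_dw {G φ : ℝ × ℝ → ℝ} (hG : ContDiff ℝ 1 G) (hφ : ContDiff ℝ 1 φ)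
    (hc : HasCompactSupport φ) :
    -∫ p, Set.indicator {p : ℝ × ℝ | p.1 * p.2 ≤ 0} G p * dw φ p =
      (∫ p in {p : ℝ × ℝ | p.1 * p.2 < 0}, dw G p * φ p) -
        ∫ z, Real.sign z * (G (0, z) * φ (0, z)) := by
  have e1 : ∫ p, Set.indicator {p : ℝ × ℝ | p.1 * p.2 ≤ 0} G p * dw φ p =
      ∫ p in {p : ℝ × ℝ | p.1 * p.2 < 0}, G p * dw φ p := by
    rw [← integral_indicator measurableSet_mul_neg]
    refine integral_congr_ae ?_
    filter_upwards [ae_mul_ne_zero] with p hp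
    rcases lt_or_gt_of_ne hp with h | h
    · simp [Set.indicator, h, h.le]
    · simp [Set.indicator, h.not_gt, h.not_ge]
  have i1 : Integrable fun p => dw G p * φ p :=
    ((continuous_dw hG).mul hφ.continuous).integrable_of_hasCompactSupport hc.mul_left
  have i2 : Integrable fun p => G p * dw φ p :=
    (hG.continuous.mul (continuous_dw hφ)).integrable_of_hasCompactSupport
      (hasCompactSupport_dw hφ hc).mul_left
  rw [e1, ← setIntegral_dw (K := fun p => G p * φ p) (hG.mul hφ) hc.mul_left]
  simp only [dw_mul hG hφ]
  rw [integral_add i1.integrableOn i2.integrableOn]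
  ring

lemma abs_sign_le_one (x : ℝ) : |Real.sign x| ≤ 1 := by
  rcases Real.sign_apply_eq x with h | h | h <;> simp [h]

lemma measurable_sign : Measurable Real.sign := by
  unfold Real.sign
  exact Measurable.ite measurableSet_Iio measurable_const
    (Measurable.ite measurableSet_Ioi measurable_const measurable_const)

lemma integrable_sign_mul {ψ : ℝ × ℝ → ℝ} (hψ : Integrable ψ) (s t : ℝ × ℝ → ℝ) (hs : Continuous s)
    (ht : Continuous t) : Integrable fun p => Real.sign (s p) * Real.sign (t p) * ψ p := by
  refine hψ.bdd_mul (c := 1) (((measurable_sign.comp hs.measurable).mul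
    (measurable_sign.comp ht.measurable)).aestronglyMeasurable) (.of_forall fun p => ?_)
  rw [norm_mul]
  exact mul_le_one₀ (abs_sign_le_one _) (norm_nonneg _) (abs_sign_le_one _)

/-- `sign z * sign (w - z)` is independent of `w` off the diagonal. -/
lemma integral_sign_mul_dw {φ : ℝ × ℝ → ℝ} (hφ : ContDiff ℝ 1 φ) (hc : HasCompactSupport φ)
    (hd : ∀ z, φ (z, z) = 0) :
    ∫ p : ℝ × ℝ, Real.sign p.2 * Real.sign (p.1 - p.2) * dw φ p = 0 := by
  rw [Measure.volume_eq_prod, integral_prod_symm]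
  · refine integral_eq_zero_of_ae (.of_forall fun z => ?_)
    have hφz : ContDiff ℝ 1 fun w => φ (w, z) := by fun_prop
    have hcz := hasCompactSupport_slice hc z
    have hi : Integrable (deriv fun w => φ (w, z)) :=
      (hφz.continuous_deriv le_rfl).integrable_of_hasCompactSupport hcz.deriv
    have key : ∫ w, Real.sign (w - z) * deriv (fun w => φ (w, z)) w = 0 := by
      -- Cutting the line at `w = z` leaves only boundary terms at the diagonal, where `φ` vanishes.
      have hsp : (fun w => Real.sign (w - z) * deriv (fun w => φ (w, z)) w) =ᵐ[volume]
          fun w => Set.indicator (Set.Ioi z) (deriv fun w => φ (w, z)) w -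
            Set.indicator (Set.Iic z) (deriv fun w => φ (w, z)) w := by
        filter_upwards [Measure.ae_ne volume z] with w hw
        rcases lt_or_gt_of_ne hw with h | h
        · simp [Real.sign_of_neg (sub_neg.2 h), h.le]
        · simp [Real.sign_of_pos (sub_pos.2 h), h]
      rw [integral_congr_ae hsp, integral_sub (hi.indicator measurableSet_Ioi)
        (hi.indicator measurableSet_Iic), integral_indicator measurableSet_Ioi,
        integral_indicator measurableSet_Iic, hcz.integral_Ioi_deriv_eq hφz,
        hcz.integral_Iic_deriv_eq hφz]
      simp [hd]
    simp only [mul_assoc, Pi.zero_apply]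
    rw [integral_const_mul]
    exact mul_eq_zero_of_right _ key
  · rw [← Measure.volume_eq_prod]
    exact integrable_sign_mul (integrable_dw hφ hc) _ _ (by fun_prop) (by fun_prop)

/-- The distributional `w`-derivative, off the diagonal, of a function that is smooth on `w z ≤ 0`
and locally constant elsewhere. -/
lemma integral_piecewise_mul_dw {g G φ : ℝ × ℝ → ℝ} (hG : ContDiff ℝ 1 G) (hφ : ContDiff ℝ 1 φ)
    (hc : HasCompactSupport φ) (hd : ∀ z, φ (z, z) = 0) (k : ℝ)
    (hg : ∀ p : ℝ × ℝ, p.1 * p.2 ≠ 0 → g p = k * (Real.sign p.2 * Real.sign (p.1 - p.2)) +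
      Set.indicator {p : ℝ × ℝ | p.1 * p.2 ≤ 0} G p) :
    -∫ p, g p * dw φ p = (∫ p in {p : ℝ × ℝ | p.1 * p.2 < 0}, dw G p * φ p) -
        ∫ z, Real.sign z * (G (0, z) * φ (0, z)) := by
  have e : (fun p => g p * dw φ p) =ᵐ[volume] fun p =>
      k * (Real.sign p.2 * Real.sign (p.1 - p.2) * dw φ p) +
        Set.indicator {p : ℝ × ℝ | p.1 * p.2 ≤ 0} G p * dw φ p := by
    filter_upwards [ae_mul_ne_zero] with p hp
    rw [hg p hp]
    ring
  have i2 : Integrable fun p => Set.indicator {p : ℝ × ℝ | p.1 * p.2 ≤ 0} G p * dw φ p := by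
    refine (((hG.continuous.mul (continuous_dw hφ)).integrable_of_hasCompactSupport
      (hasCompactSupport_dw hφ hc).mul_left).indicator measurableSet_mul_nonpos).congr
        (.of_forall fun p => ?_)
    simp only [Set.indicator]
    split_ifs <;> simp
  rw [integral_congr_ae e, integral_add ((integrable_sign_mul (integrable_dw hφ hc) _ _
    (by fun_prop) (by fun_prop)).const_mul k) i2, integral_const_mul,
    integral_sign_mul_dw hφ hc hd, mul_zero, zero_add,
    integral_indicator_mul_dw hG hφ hc]

lemma integral_swap (f : ℝ × ℝ → ℝ) : ∫ p : ℝ × ℝ, f p.swap = ∫ p, f p := by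
  rw [Measure.volume_eq_prod]
  exact integral_prod_swap f

lemma hasCompactSupport_swap {φ : ℝ × ℝ → ℝ} (hc : HasCompactSupport φ) :
    HasCompactSupport fun p : ℝ × ℝ => φ p.swap :=
  hc.comp_homeomorph (Homeomorph.prodComm ℝ ℝ)

lemma contDiff_swap {n : WithTop ℕ∞} {φ : ℝ × ℝ → ℝ} (h : ContDiff ℝ n φ) :
    ContDiff ℝ n fun p : ℝ × ℝ => φ p.swap :=
  h.comp (contDiff_snd.prodMk contDiff_fst)

lemma setIntegral_mul_neg_swap (f : ℝ × ℝ → ℝ) :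
    ∫ p in {p : ℝ × ℝ | p.1 * p.2 < 0}, f p.swap = ∫ p in {p : ℝ × ℝ | p.1 * p.2 < 0}, f p := by
  rw [← integral_indicator measurableSet_mul_neg, ← integral_indicator measurableSet_mul_neg,
    ← integral_swap]
  congr 1
  funext p
  simp [Set.indicator, mul_comm]

lemma integral_indicator_mul_dz {G φ : ℝ × ℝ → ℝ} (hG : ContDiff ℝ 1 G) (hφ : ContDiff ℝ 1 φ)
    (hc : HasCompactSupport φ) :
    -∫ p, Set.indicator {p : ℝ × ℝ | p.1 * p.2 ≤ 0} G p * dz φ p =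
      (∫ p in {p : ℝ × ℝ | p.1 * p.2 < 0}, dz G p * φ p) -
        ∫ w, Real.sign w * (G (w, 0) * φ (w, 0)) := by
  have := integral_indicator_mul_dw (contDiff_swap hG) (contDiff_swap hφ) (hasCompactSupport_swap hc)
  rw [← integral_swap, ← setIntegral_mul_neg_swap]
  refine Eq.trans ?_ this
  congr 2
  funext p
  simp only [Set.indicator, Set.mem_ofPred_eq, Prod.fst_swap, Prod.snd_swap, mul_comm p.2]
  rfl

lemma integral_piecewise_mul_dz {g G φ : ℝ × ℝ → ℝ} (hG : ContDiff ℝ 1 G) (hφ : ContDiff ℝ 1 φ)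
    (hc : HasCompactSupport φ) (hd : ∀ z, φ (z, z) = 0) (k : ℝ)
    (hg : ∀ p : ℝ × ℝ, p.1 * p.2 ≠ 0 → g p = k * (Real.sign p.1 * Real.sign (p.2 - p.1)) +
      Set.indicator {p : ℝ × ℝ | p.1 * p.2 ≤ 0} G p) :
    -∫ p, g p * dz φ p = (∫ p in {p : ℝ × ℝ | p.1 * p.2 < 0}, dz G p * φ p) -
        ∫ w, Real.sign w * (G (w, 0) * φ (w, 0)) := by
  have := integral_piecewise_mul_dw (g := fun p => g p.swap) (contDiff_swap hG) (contDiff_swap hφ)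
    (hasCompactSupport_swap hc) hd k (fun p hp => by
      rw [hg p.swap (by simpa [mul_comm] using hp)]
      simp [Set.indicator, mul_comm p.2])
  rw [← integral_swap, ← setIntegral_mul_neg_swap]
  exact this

/-! ### Functions with vanishing weak gradient. -/

lemma integrable_mul_of_tsupport_subset {Ω : Set (ℝ × ℝ)} {τ ψ : ℝ × ℝ → ℝ}
    (hτ : LocallyIntegrableOn τ Ω) (hψ : Continuous ψ) (hc : HasCompactSupport ψ)
    (hs : tsupport ψ ⊆ Ω) : Integrable fun x => τ x * ψ x := by
  have hK : IntegrableOn τ (tsupport ψ) := hτ.integrableOn_compact_subset hs hc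
  refine (integrableOn_iff_integrable_of_support_subset ?_).1
    (hK.mul_continuousOn hψ.continuousOn hc)
  exact (Function.support_mul_subset_right _ _).trans (subset_tsupport ψ)

/-- Fubini's theorem for a locally integrable function against a bounded kernel. -/
lemma integral_mul_integral_swap {Y : Type*} [MeasurableSpace Y] {ν : Measure Y} [IsFiniteMeasure ν]
    {Ω K : Set (ℝ × ℝ)} {τ : ℝ × ℝ → ℝ} {k : (ℝ × ℝ) → Y → ℝ} (hτ : LocallyIntegrableOn τ Ω)
    (hK : IsCompact K) (hKΩ : K ⊆ Ω) (hk : AEStronglyMeasurable (Function.uncurry k) (volume.prod ν))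
    (C : ℝ) (hC : ∀ x y, |k x y| ≤ C) (h0 : ∀ᵐ y ∂ν, ∀ x ∉ K, k x y = 0) :
    ∫ x, τ x * (∫ y, k x y ∂ν) = ∫ y, (∫ x, τ x * k x y) ∂ν := by
  have hi : Integrable (K.indicator τ) :=
    (integrable_indicator_iff hK.measurableSet).2 (hτ.integrableOn_compact_subset hKΩ hK)
  have h1 : ∫ x, τ x * (∫ y, k x y ∂ν) = ∫ x, (∫ y, K.indicator τ x * k x y ∂ν) := by
    congr 1
    funext x
    rw [integral_const_mul]
    by_cases hx : x ∈ K
    · simp [hx]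
    · have : ∫ y, k x y ∂ν = 0 := integral_eq_zero_of_ae (h0.mono fun y hy => hy x hx)
      simp [this]
  rw [h1, integral_integral_swap]
  · refine integral_congr_ae (h0.mono fun y hy => ?_)
    simp only
    congr 1
    funext x
    by_cases hx : x ∈ K
    · simp [hx]
    · simp [hx, hy x hx]
  · have := (hi.mul_prod (integrable_const (1 : ℝ) (μ := ν))).bdd_mul (c := C) hk
      (.of_forall fun z => hC z.1 z.2)
    refine this.congr (.of_forall fun z => ?_)
    simp [Function.uncurry, mul_comm]

lemma IsTestFunction.translate {Ω : Set (ℝ × ℝ)} {φ : ℝ × ℝ → ℝ} (hφ : IsTestFunction Ω φ)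
    {h : ℝ × ℝ} (hh : ∀ x ∈ Ω, x + h ∈ Ω) : IsTestFunction Ω fun x => φ (x - h) where
  contDiff := hφ.contDiff.comp (by fun_prop)
  hasCompactSupport := hφ.hasCompactSupport.comp_homeomorph (Homeomorph.subRight h)
  tsupport_subset := by
    intro x hx
    have := tsupport_comp_subset_preimage φ (f := fun x => x - h) (by fun_prop) hx
    simpa using hh _ (hφ.tsupport_subset this)

lemma IsTestFunction.fderiv_apply_bound {Ω : Set (ℝ × ℝ)} {φ : ℝ × ℝ → ℝ}
    (hφ : IsTestFunction Ω φ) (h : ℝ × ℝ) :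
    Continuous (fun x => fderiv ℝ φ x h) ∧ (∃ C, ∀ x, |fderiv ℝ φ x h| ≤ C) ∧
      ∀ x ∉ tsupport φ, fderiv ℝ φ x h = 0 := by
  have hcont : Continuous (fun x => fderiv ℝ φ x h) :=
    (hφ.contDiff.continuous_fderiv (by simp)).clm_apply continuous_const
  have hcs : HasCompactSupport (fun x => fderiv ℝ φ x h) :=
    (hφ.hasCompactSupport.fderiv (𝕜 := ℝ)).comp_left (g := fun L : ℝ × ℝ →L[ℝ] ℝ => L h) rfl
  refine ⟨hcont, hcs.exists_bound_of_continuous hcont, fun x hx => ?_⟩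
  rw [fderiv_of_notMem_tsupport ℝ hx]
  rfl

/-- A function with vanishing weak gradient has translation invariant pairings. -/
lemma integral_translate_eq {Ω : Set (ℝ × ℝ)} {τ φ : ℝ × ℝ → ℝ}
    (hτ : LocallyIntegrableOn τ Ω) {h : ℝ × ℝ} (hcone : ∀ x ∈ Ω, ∀ t : ℝ, 0 ≤ t → x + t • h ∈ Ω)
    (hgrad : ∀ φ, IsTestFunction Ω φ → ∫ x, τ x * fderiv ℝ φ x h = 0)
    (hφ : IsTestFunction Ω φ) :
    ∫ x, τ x * φ (x - h) = ∫ x, τ x * φ x := by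
  obtain ⟨hcont, ⟨C, hC⟩, hz⟩ := hφ.fderiv_apply_bound h
  have ht (t : ℝ) (h0 : 0 ≤ t) : IsTestFunction Ω fun x => φ (x - t • h) :=
    hφ.translate fun x hx => hcone x hx t h0
  have hsub (x : ℝ × ℝ) :
      ∫ t in Set.Ioc (0 : ℝ) 1, -fderiv ℝ φ (x - t • h) h = φ (x - h) - φ x := by
    rw [← intervalIntegral.integral_of_le zero_le_one,
      intervalIntegral.integral_eq_sub_of_hasDerivAt (f := fun t : ℝ => φ (x - t • h))]
    · simp
    · intro t _
      have h1 : HasDerivAt (fun t : ℝ => x - t • h) (-h) t := by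
        simpa using ((hasDerivAt_id t).smul_const h).const_sub x
      have := ((hφ.contDiff.differentiable (by simp)) (x - t • h)).hasFDerivAt.comp_hasDerivAt t h1
      simpa [Function.comp_def] using this
    · refine Continuous.intervalIntegrable ?_ _ _
      exact (hcont.comp (by fun_prop : Continuous fun t : ℝ => x - t • h)).neg
  -- The compact set is the region swept out by the support of `φ` moving along `h`; the cone
  -- condition keeps it in `Ω`. After exchanging the integrals, each `t` contributes the weak
  -- derivative tested against a translate of `φ`, which is zero.
  have key := integral_mul_integral_swap (ν := volume.restrict (Set.Ioc (0 : ℝ) 1))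
    (K := (fun y : (ℝ × ℝ) × ℝ => y.1 + y.2 • h) '' (tsupport φ ×ˢ Set.Icc (0 : ℝ) 1))
    (k := fun x t => -fderiv ℝ φ (x - t • h) h) hτ
    ((hφ.hasCompactSupport.prod isCompact_Icc).image (by fun_prop))
    (by
      rintro _ ⟨y, ⟨hy1, hy2⟩, rfl⟩
      exact hcone _ (hφ.tsupport_subset hy1) _ hy2.1)
    ((hcont.comp (by fun_prop : Continuous fun y : (ℝ × ℝ) × ℝ => y.1 - y.2 • h)).neg.aestronglyMeasurable)
    C (fun x t => by rw [abs_neg]; exact hC _)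
    (by
      filter_upwards [ae_restrict_mem measurableSet_Ioc] with t htt x hx
      rw [hz, neg_zero]
      intro hxt
      exact hx ⟨(x - t • h, t), ⟨hxt, htt.1.le, htt.2⟩, by simp⟩)
  have hzero : ∫ x, τ x * (φ (x - h) - φ x) = 0 := by
    simp only [← hsub]
    rw [key]
    refine integral_eq_zero_of_ae ?_
    filter_upwards [ae_restrict_mem measurableSet_Ioc] with t htt
    have := hgrad _ (ht t htt.1.le)
    simp only [mul_neg, integral_neg, Pi.zero_apply, neg_eq_zero]
    rw [← this]
    congr 1
    funext x
    simp only [sub_eq_add_neg]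
    rw [fderiv_comp_add_right (𝕜 := ℝ) (f := φ)]
  have h1 := ht 1 zero_le_one
  simp only [one_smul] at h1
  simp only [mul_sub] at hzero
  rw [integral_sub
    (integrable_mul_of_tsupport_subset hτ h1.contDiff.continuous h1.hasCompactSupport
      h1.tsupport_subset)
    (integrable_mul_of_tsupport_subset hτ hφ.contDiff.continuous hφ.hasCompactSupport
      hφ.tsupport_subset)] at hzero
  linarith

/-- The convolution is a superposition of the translates `φ (· - h)` with weights `ψ h`, and all of
these have the same pairing with `τ`. -/
lemma integral_mul_convolution {Ω : Set (ℝ × ℝ)} {τ φ ψ : ℝ × ℝ → ℝ}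
    (hτ : LocallyIntegrableOn τ Ω) (hadd : ∀ x ∈ Ω, ∀ h ∈ Ω, x + h ∈ Ω)
    (hinv : ∀ h ∈ Ω, ∫ x, τ x * φ (x - h) = ∫ x, τ x * φ x)
    (hφ : IsTestFunction Ω φ) (hψ : IsTestFunction Ω ψ) :
    ∫ x, τ x * ∫ h, φ (x - h) * ψ h = (∫ x, τ x * φ x) * ∫ h, ψ h := by
  have hφc := hφ.contDiff.continuous
  have hψc := hψ.contDiff.continuous
  obtain ⟨C, hC⟩ := hφ.hasCompactSupport.exists_bound_of_continuous hφc
  obtain ⟨D, hD⟩ := hψ.hasCompactSupport.exists_bound_of_continuous hψc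
  have hfin : IsFiniteMeasure (volume.restrict (tsupport ψ)) :=
    ⟨by rw [Measure.restrict_apply_univ]; exact hψ.hasCompactSupport.measure_lt_top⟩
  have hm : MeasurableSet (tsupport ψ) := (isClosed_tsupport ψ).measurableSet
  have key := integral_mul_integral_swap (ν := volume.restrict (tsupport ψ))
    (K := (fun y : (ℝ × ℝ) × (ℝ × ℝ) => y.1 + y.2) '' (tsupport φ ×ˢ tsupport ψ))
    (k := fun x h => φ (x - h) * ψ h) hτ
    ((hφ.hasCompactSupport.prod hψ.hasCompactSupport).image (by fun_prop))
    (by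
      rintro _ ⟨y, ⟨hy1, hy2⟩, rfl⟩
      exact hadd _ (hφ.tsupport_subset hy1) _ (hψ.tsupport_subset hy2))
    ((by fun_prop : Continuous fun y : (ℝ × ℝ) × (ℝ × ℝ) =>
      φ (y.1 - y.2) * ψ y.2).aestronglyMeasurable)
    (C * D) (fun x h => by
      rw [abs_mul]
      exact mul_le_mul (hC _) (hD _) (abs_nonneg _) ((norm_nonneg _).trans (hC 0)))
    (by
      filter_upwards [ae_restrict_mem hm] with h hh x hx
      rw [image_eq_zero_of_notMem_tsupport (f := φ), zero_mul]
      intro hxt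
      exact hx ⟨(x - h, h), ⟨hxt, hh⟩, by simp⟩)
  have e1 (x : ℝ × ℝ) : ∫ h in tsupport ψ, φ (x - h) * ψ h = ∫ h, φ (x - h) * ψ h :=
    setIntegral_eq_integral_of_forall_compl_eq_zero fun h hh => by
      rw [image_eq_zero_of_notMem_tsupport hh, mul_zero]
  have e2 : ∫ h in tsupport ψ, ψ h = ∫ h, ψ h :=
    setIntegral_eq_integral_of_forall_compl_eq_zero fun h hh => image_eq_zero_of_notMem_tsupport hh
  simp only [e1] at key
  rw [key, ← e2, ← integral_const_mul]
  refine setIntegral_congr_fun hm fun h hh => ?_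
  simp only [← mul_assoc, integral_mul_const, hinv h (hψ.tsupport_subset hh)]

/-- A function with vanishing weak gradient on an open convex cone is constant. -/
lemma ae_const_of_weak_gradient_zero {Ω : Set (ℝ × ℝ)} {τ : ℝ × ℝ → ℝ} (hΩ : IsOpen Ω)
    (hne : Ω.Nonempty) (hτ : LocallyIntegrableOn τ Ω)
    (hcone : ∀ x ∈ Ω, ∀ h ∈ Ω, ∀ t : ℝ, 0 ≤ t → x + t • h ∈ Ω)
    (hgrad : ∀ φ, IsTestFunction Ω φ → ∀ h, ∫ x, τ x * fderiv ℝ φ x h = 0) :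
    ∃ c, ∀ᵐ x, x ∈ Ω → τ x = c := by
  have hadd : ∀ x ∈ Ω, ∀ h ∈ Ω, x + h ∈ Ω := fun x hx h hh => by
    simpa using hcone x hx h hh 1 zero_le_one
  -- Convolution is commutative, so evaluating the pairing of `τ` with `φ * ψ` in both orders shows
  -- that the pairing is proportional to the integral of the test function. A bump of integral `1`
  -- then supplies the constant.
  have hsymm {φ ψ : ℝ × ℝ → ℝ} (hφ : IsTestFunction Ω φ) (hψ : IsTestFunction Ω ψ) :
      (∫ x, τ x * φ x) * ∫ h, ψ h = (∫ x, τ x * ψ x) * ∫ h, φ h := by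
    rw [← integral_mul_convolution hτ hadd (fun h hh => integral_translate_eq hτ
        (fun x hx => hcone x hx h hh) (fun φ hφ => hgrad φ hφ h) hφ) hφ hψ,
      ← integral_mul_convolution hτ hadd (fun h hh => integral_translate_eq hτ
        (fun x hx => hcone x hx h hh) (fun φ hφ => hgrad φ hφ h) hψ) hψ hφ]
    congr 1
    funext x
    congr 1
    rw [← integral_sub_left_eq_self _ volume x]
    simp only [sub_sub_cancel, mul_comm]
  obtain ⟨x₀, hx₀⟩ := hne
  obtain ⟨r, hr, hball⟩ := Metric.isOpen_iff.1 hΩ x₀ hx₀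
  let b : ContDiffBump x₀ := ⟨r / 4, r / 2, by positivity, by linarith⟩
  have hb : IsTestFunction Ω (b.normed volume) :=
    ⟨b.contDiff_normed, b.hasCompactSupport_normed, by
      rw [b.tsupport_normed_eq]
      exact (Metric.closedBall_subset_ball (by simp only [b]; linarith)).trans hball⟩
  refine ⟨∫ x, τ x * b.normed volume x, ?_⟩
  have := hΩ.ae_eq_zero_of_integral_contDiff_smul_eq_zero (μ := volume)
    (f := fun x => τ x - ∫ x, τ x * b.normed volume x)
    (hτ.sub ((locallyIntegrable_const _).locallyIntegrableOn Ω)) (fun φ h1 h2 h3 => by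
      have hφ : IsTestFunction Ω φ := ⟨h1, h2, h3⟩
      have := hsymm hφ hb
      rw [b.integral_normed, mul_one] at this
      simp only [smul_eq_mul, mul_sub]
      rw [integral_sub, integral_mul_const]
      · simp only [mul_comm (φ _)]
        rw [this]
        ring
      · simpa only [mul_comm] using
          integrable_mul_of_tsupport_subset hτ h1.continuous h2 h3
      · exact (h1.continuous.integrable_of_hasCompactSupport h2).mul_const _)
  filter_upwards [this] with x hx hxΩ
  exact sub_eq_zero.1 (hx hxΩ)

/-! ### Uniqueness of the entropy flux kernel. -/

lemma ae_mem_nonunitDensity : ∀ᵐ p : ℝ × ℝ, p ∈ nonunitDensity := by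
  have := Measure.addHaar_submodule (volume : Measure (ℝ × ℝ))
    (LinearMap.ker (LinearMap.fst ℝ ℝ ℝ - LinearMap.snd ℝ ℝ ℝ)) (fun h => by
      have h1 : ((1, 0) : ℝ × ℝ) ∈ (⊤ : Submodule ℝ (ℝ × ℝ)) := trivial
      rw [← h] at h1
      simp at h1)
  refine measure_mono_null (fun p hp => ?_) this
  simpa [nonunitDensity, sub_eq_zero] using hp

lemma IsTestFunction.mono {Ω Ω' : Set (ℝ × ℝ)} {φ : ℝ × ℝ → ℝ} (hφ : IsTestFunction Ω φ)
    (h : Ω ⊆ Ω') : IsTestFunction Ω' φ :=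
  ⟨hφ.contDiff, hφ.hasCompactSupport, hφ.tsupport_subset.trans h⟩

lemma IsTestFunction.contDiff_one {Ω : Set (ℝ × ℝ)} {φ : ℝ × ℝ → ℝ} (hφ : IsTestFunction Ω φ) :
    ContDiff ℝ 1 φ := by
  exact_mod_cast contDiff_infty.1 hφ.contDiff 1

lemma IsTestFunction.eq_zero_of_diagonal {φ : ℝ × ℝ → ℝ} (hφ : IsTestFunction nonunitDensity φ)
    (z : ℝ) : φ (z, z) = 0 :=
  image_eq_zero_of_notMem_tsupport fun h => hφ.tsupport_subset h rfl

lemma IsEntropyFluxKernel.ae_const_sub {ε : ℝ} {χ σ σ' : ℝ × ℝ → ℝ}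
    (h : IsEntropyFluxKernel ε χ σ) (h' : IsEntropyFluxKernel ε χ σ') {Ω : Set (ℝ × ℝ)}
    (hΩ : IsOpen Ω) (hne : Ω.Nonempty) (hsub : Ω ⊆ nonunitDensity)
    (hcone : ∀ x ∈ Ω, ∀ h ∈ Ω, ∀ t : ℝ, 0 ≤ t → x + t • h ∈ Ω) :
    ∃ c, ∀ᵐ x, x ∈ Ω → σ x - σ' x = c := by
  have hl := h.locallyIntegrableOn.mono_set hsub
  have hl' := h'.locallyIntegrableOn.mono_set hsub
  refine ae_const_of_weak_gradient_zero hΩ hne (hl.sub hl') hcone fun φ hφ v => ?_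
  have hφ' := hφ.mono hsub
  have key (e : ℝ × ℝ) (D : ℝ × ℝ → ℝ) (hD : ∀ x, D x = fderiv ℝ φ x e)
      (heq : ∫ x, σ x * D x = ∫ x, σ' x * D x) :
      Integrable (fun x => (σ x - σ' x) * D x) ∧ ∫ x, (σ x - σ' x) * D x = 0 := by
    obtain ⟨hcont, -, hz⟩ := hφ.fderiv_apply_bound e
    have hs : tsupport (fun x => fderiv ℝ φ x e) ⊆ tsupport φ :=
      closure_minimal (fun x hx => not_not.1 fun hn => hx (hz x hn)) (isClosed_tsupport φ)
    have hc : HasCompactSupport (fun x => fderiv ℝ φ x e) :=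
      hφ.hasCompactSupport.mono' (subset_closure.trans hs)
    obtain rfl : D = _ := funext hD
    have i1 := integrable_mul_of_tsupport_subset hl hcont hc (hs.trans hφ.tsupport_subset)
    have i2 := integrable_mul_of_tsupport_subset hl' hcont hc (hs.trans hφ.tsupport_subset)
    simp only [sub_mul]
    exact ⟨i1.sub i2, by rw [integral_sub i1 i2, heq, sub_self]⟩
  have hp := (hφ.contDiff.differentiable (by simp)).hasPartials
  obtain ⟨iw, ew⟩ := key (1, 0) (dw φ) (fun x => by simp [(hp x).fderiv])
    (neg_injective ((h.eq_w φ hφ').trans (h'.eq_w φ hφ').symm))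
  obtain ⟨iz, ez⟩ := key (0, 1) (dz φ) (fun x => by simp [(hp x).fderiv])
    (neg_injective ((h.eq_z φ hφ').trans (h'.eq_z φ hφ').symm))
  have : (fun x => (σ x - σ' x) * fderiv ℝ φ x v) = fun x =>
      v.1 * ((σ x - σ' x) * dw φ x) + v.2 * ((σ x - σ' x) * dz φ x) := by
    funext x
    rw [(hp x).fderiv]
    simp
    ring
  rw [this, integral_add (iw.const_mul _) (iz.const_mul _), integral_const_mul, integral_const_mul,
    ew, ez]
  simp

/-- The terms `u χ` cancel in the difference, so the normalisation forces `σ - σ' → 0` at the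
origin; `hacc` ensures that `Ω` reaches the origin inside `w z < 0`. -/
lemma IsEntropyFluxKernel.ae_eq_on {ε : ℝ} {χ σ σ' : ℝ × ℝ → ℝ}
    (h : IsEntropyFluxKernel ε χ σ) (h' : IsEntropyFluxKernel ε χ σ') {Ω : Set (ℝ × ℝ)}
    (hΩ : IsOpen Ω) (hne : Ω.Nonempty) (hsub : Ω ⊆ nonunitDensity)
    (hcone : ∀ x ∈ Ω, ∀ h ∈ Ω, ∀ t : ℝ, 0 ≤ t → x + t • h ∈ Ω)
    (hacc : ∀ r : ℝ, 0 < r → ∃ p ∈ Ω, p.1 * p.2 < 0 ∧ p ∈ Metric.ball 0 r) :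
    ∀ᵐ x, x ∈ Ω → σ x = σ' x := by
  obtain ⟨c, hc⟩ := h.ae_const_sub h' hΩ hne hsub hcone
  have hlim : Tendsto (fun p => σ p - σ' p) (𝓝[{p : ℝ × ℝ | p.1 * p.2 < 0}] (0, 0)) (𝓝 0) := by
    have := h.sharp_zero.sub h'.sharp_zero
    simpa [sharp] using this
  have hc0 : c = 0 := by
    by_contra hne
    have hev := hlim.eventually (Metric.ball_mem_nhds 0 (abs_pos.2 hne))
    obtain ⟨r, hr, hball⟩ := Metric.mem_nhdsWithin_iff.1 hev
    obtain ⟨p, hp, hpn, hpr⟩ := hacc r hr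
    have hopen : IsOpen (Ω ∩ ({p : ℝ × ℝ | p.1 * p.2 < 0} ∩ Metric.ball 0 r)) :=
      hΩ.inter ((isOpen_lt (by fun_prop) (by fun_prop)).inter Metric.isOpen_ball)
    obtain ⟨x, ⟨hx, hxn, hxr⟩, hxc⟩ :=
      (Measure.dense_of_ae hc).inter_open_nonempty _ hopen ⟨p, hp, hpn, hpr⟩
    have := hball ⟨hxr, hxn⟩
    simp only [Set.mem_ofPred_eq] at hxc
    simp [hxc hx] at this
  filter_upwards [hc] with x hx hxΩ
  linarith [hx hxΩ]

theorem IsEntropyFluxKernel.ae_eq {ε : ℝ} {χ σ σ' : ℝ × ℝ → ℝ}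
    (h : IsEntropyFluxKernel ε χ σ) (h' : IsEntropyFluxKernel ε χ σ') : σ =ᵐ[volume] σ' := by
  have hlt := h.ae_eq_on h' (Ω := {p | p.1 < p.2}) (isOpen_lt continuous_fst continuous_snd)
    ⟨(0, 1), by simp⟩ (fun p hp => (show p.1 < p.2 from hp).ne)
    (fun x (hx : x.1 < x.2) y (hy : y.1 < y.2) t ht => by
      simp only [Set.mem_ofPred_eq, Prod.fst_add, Prod.snd_add, Prod.smul_fst, Prod.smul_snd,
        smul_eq_mul]
      nlinarith)
    (fun r hr => ⟨(-(r / 2), r / 2), by simp only [Set.mem_ofPred_eq]; linarith, by nlinarith, by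
      simp [Prod.norm_def, abs_of_pos hr, hr]⟩)
  have hgt := h.ae_eq_on h' (Ω := {p | p.2 < p.1}) (isOpen_lt continuous_snd continuous_fst)
    ⟨(1, 0), by simp⟩ (fun p hp => (show p.2 < p.1 from hp).ne')
    (fun x (hx : x.2 < x.1) y (hy : y.2 < y.1) t ht => by
      simp only [Set.mem_ofPred_eq, Prod.fst_add, Prod.snd_add, Prod.smul_fst, Prod.smul_snd,
        smul_eq_mul]
      nlinarith)
    (fun r hr => ⟨(r / 2, -(r / 2)), by simp only [Set.mem_ofPred_eq]; linarith, by nlinarith, by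
      simp [Prod.norm_def, abs_of_pos hr, hr]⟩)
  filter_upwards [hlt, hgt, ae_mem_nonunitDensity] with p h1 h2 h3
  exact (lt_or_gt_of_ne h3).elim h1 h2

/-! ### Existence of the entropy flux kernel. -/

/-- The flux `F` on `w z ≤ 0`, continued by `± 1`. -/
noncomputable def fluxKernel (F : ℝ × ℝ → ℝ) (p : ℝ × ℝ) : ℝ :=
  Set.indicator {p : ℝ × ℝ | p.1 * p.2 ≤ 0} F p +
    Set.indicator {p : ℝ × ℝ | 0 < p.1 * p.2} (fun p => Real.sign p.2 * Real.sign (p.1 - p.2)) p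

lemma fluxKernel_of_neg {F : ℝ × ℝ → ℝ} {p : ℝ × ℝ} (h : p.1 * p.2 < 0) : fluxKernel F p = F p := by
  simp [fluxKernel, Set.indicator, h.le, h.not_gt]

lemma fluxKernel_of_pos {F : ℝ × ℝ → ℝ} {p : ℝ × ℝ} (h : 0 < p.1 * p.2) :
    fluxKernel F p = Real.sign p.2 * Real.sign (p.1 - p.2) := by
  simp [fluxKernel, Set.indicator, h, h.not_ge]

/-- The sign product is `-1` where `w z < 0`, so subtracting it everywhere replaces `F` by `F + 1`.
The subtracted part has no `w`-derivative off the diagonal, and `F + 1 = λ₂ u` on `w = 0`. -/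
lemma fluxKernel_eq_w {F : ℝ × ℝ → ℝ} {p : ℝ × ℝ} (h : p.1 * p.2 ≠ 0) :
    fluxKernel F p = 1 * (Real.sign p.2 * Real.sign (p.1 - p.2)) +
      Set.indicator {p : ℝ × ℝ | p.1 * p.2 ≤ 0} (fun p => F p + 1) p := by
  rcases lt_or_gt_of_ne h with h | h
  · rw [fluxKernel_of_neg h]
    rcases mul_neg_iff.1 h with ⟨h1, h2⟩ | ⟨h1, h2⟩
    · simp [Set.indicator, h.le, Real.sign_of_neg h2, Real.sign_of_pos (show 0 < p.1 - p.2 by linarith)]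
    · simp [Set.indicator, h.le, Real.sign_of_pos h2, Real.sign_of_neg (show p.1 - p.2 < 0 by linarith)]
  · rw [fluxKernel_of_pos h]
    simp [Set.indicator, h.not_ge]

/-- For `z`-derivatives the sign product must be independent of `z`; where `w z > 0` it is the same
function since `w` and `z` have equal signs. The remainder `F - 1` equals `λ₁ u` on `z = 0`. -/
lemma fluxKernel_eq_z {F : ℝ × ℝ → ℝ} {p : ℝ × ℝ} (h : p.1 * p.2 ≠ 0) :
    fluxKernel F p = -1 * (Real.sign p.1 * Real.sign (p.2 - p.1)) +
      Set.indicator {p : ℝ × ℝ | p.1 * p.2 ≤ 0} (fun p => F p - 1) p := by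
  rcases lt_or_gt_of_ne h with h | h
  · rw [fluxKernel_of_neg h]
    rcases mul_neg_iff.1 h with ⟨h1, h2⟩ | ⟨h1, h2⟩
    · simp [Set.indicator, h.le, Real.sign_of_pos h1, Real.sign_of_neg (show p.2 - p.1 < 0 by linarith)]
    · simp [Set.indicator, h.le, Real.sign_of_neg h1, Real.sign_of_pos (show 0 < p.2 - p.1 by linarith)]
  · rw [fluxKernel_of_pos h, ← neg_sub p.1 p.2, Real.sign_neg]
    rcases mul_pos_iff.1 h with ⟨h1, h2⟩ | ⟨h1, h2⟩
    · simp [Set.indicator, h.not_ge, Real.sign_of_pos h1, Real.sign_of_pos h2]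
    · simp [Set.indicator, h.not_ge, Real.sign_of_neg h1, Real.sign_of_neg h2]

lemma locallyIntegrable_fluxKernel {F : ℝ × ℝ → ℝ} (hF : Continuous F) :
    LocallyIntegrable (fluxKernel F) := by
  refine (hF.locallyIntegrable.indicator measurableSet_mul_nonpos).add ?_
  refine LocallyIntegrable.indicator ?_ (measurableSet_lt (by fun_prop) (by fun_prop))
  refine (locallyIntegrable_const (1 : ℝ)).mono ?_ (.of_forall fun p => ?_)
  · exact ((measurable_sign.comp measurable_snd).mul
      (measurable_sign.comp (measurable_fst.sub measurable_snd))).aestronglyMeasurable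
  · rw [norm_mul, norm_one]
    exact mul_le_one₀ (abs_sign_le_one _) (norm_nonneg _) (abs_sign_le_one _)

lemma entropyKernel_eq_indicator {R : ℝ → ℝ → ℝ → ℝ → ℝ} {u : ℝ × ℝ → ℝ}
    (h : ∀ w z, R 0 0 w z = u (w, z)) :
    entropyKernel R = Set.indicator {p : ℝ × ℝ | p.1 * p.2 ≤ 0} u := by
  funext p
  simp [entropyKernel, Set.indicator, h]

lemma HasPartials.dw_eq {G p q : ℝ × ℝ → ℝ} (h : HasPartials G p q) (x : ℝ × ℝ) : dw G x = p x :=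
  (h.hasDerivAt_fst x.1 x.2).deriv

lemma HasPartials.dz_eq {G p q : ℝ × ℝ → ℝ} (h : HasPartials G p q) (x : ℝ × ℝ) : dz G x = q x :=
  (h.hasDerivAt_snd x.1 x.2).deriv

lemma isEntropyFluxKernel_fluxKernel {ε : ℝ} (h0 : 0 < ε) (h1 : ε < 1) {u p q F : ℝ × ℝ → ℝ}
    (hu : IsGoursatSolution ε 0 0 u p q) (hF : ContDiff ℝ ∞ F)
    (hFp : HasPartials F (fun x => lam2 ε x.1 x.2 * p x) (fun x => lam1 ε x.1 x.2 * q x))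
    (hFw : ∀ w, F (w, 0) = lam1 ε w 0 * u (w, 0) + 1)
    (hFz : ∀ z, F (0, z) = lam2 ε 0 z * u (0, z) - 1) (hF0 : F (0, 0) = 0) :
    IsEntropyFluxKernel ε (Set.indicator {p : ℝ × ℝ | p.1 * p.2 ≤ 0} u) (fluxKernel F) where
  locallyIntegrableOn := (locallyIntegrable_fluxKernel hF.continuous).locallyIntegrableOn _
  eq_w φ hφ := by
    have cF : ContDiff ℝ 1 F := by exact_mod_cast contDiff_infty.1 hF 1
    have cu : ContDiff ℝ 1 u := by exact_mod_cast contDiff_infty.1 hu.contDiff 1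
    have cl : ContDiff ℝ 1 fun x : ℝ × ℝ => lam2 ε x.1 x.2 := by
      exact_mod_cast contDiff_infty.1 (contDiff_lam2 h0 h1) 1
    rw [integral_piecewise_mul_dw (G := fun p => F p + 1) (cF.add contDiff_const)
        hφ.contDiff_one hφ.hasCompactSupport hφ.eq_zero_of_diagonal 1
        (fun p hp => fluxKernel_eq_w hp),
      integral_indicator_mul_dw cu (cl.mul hφ.contDiff_one) hφ.hasCompactSupport.mul_left]
    congr 1
    -- The regular parts agree because `F_w = λ₂ u_w`, and the boundary parts because `F + 1 = λ₂ u`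
    -- on `w = 0`.
    · congr 1
      funext x
      rw [(hFp.add_const 1).dw_eq, hu.hasPartials.dw_eq]
      ring
    · congr 1
      funext z
      simp only [hFz]
      ring
  eq_z φ hφ := by
    have cF : ContDiff ℝ 1 F := by exact_mod_cast contDiff_infty.1 hF 1
    have cu : ContDiff ℝ 1 u := by exact_mod_cast contDiff_infty.1 hu.contDiff 1
    have cl : ContDiff ℝ 1 fun x : ℝ × ℝ => lam1 ε x.1 x.2 := by
      exact_mod_cast contDiff_infty.1 (contDiff_lam1 h0 h1) 1
    rw [integral_piecewise_mul_dz (G := fun p => F p - 1) (cF.sub contDiff_const)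
        hφ.contDiff_one hφ.hasCompactSupport hφ.eq_zero_of_diagonal (-1)
        (fun p hp => fluxKernel_eq_z hp),
      integral_indicator_mul_dz cu (cl.mul hφ.contDiff_one) hφ.hasCompactSupport.mul_left]
    congr 1
    · congr 1
      funext x
      rw [show dz (fun p => F p - 1) x = _ from (hFp.add_const (-1)).dz_eq x, hu.hasPartials.dz_eq]
      ring
    · congr 1
      funext w
      simp only [hFw]
      ring
  sharp_zero := by
    have : Tendsto (fun p : ℝ × ℝ => F p - (p.1 + p.2) / 2 * u p)
        (𝓝[{p : ℝ × ℝ | p.1 * p.2 < 0}] (0, 0)) (𝓝 0) := by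
      have hc : Continuous fun p : ℝ × ℝ => F p - (p.1 + p.2) / 2 * u p := by
        have := hF.continuous
        have := hu.contDiff.continuous
        fun_prop
      have := hc.tendsto (0, 0)
      simp only [hF0, add_zero, zero_div, zero_mul, sub_zero] at this
      exact this.mono_left nhdsWithin_le_nhds
    refine this.congr' ?_
    filter_upwards [self_mem_nhdsWithin] with p hp
    have hp : p.1 * p.2 < 0 := hp
    simp [sharp, fluxKernel_of_neg hp, Set.indicator, hp.le]

/-! ### The derivatives of the modified flux kernel. -/

lemma abs_eq_sign_mul (x : ℝ) : |x| = Real.sign x * x := by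
  rcases lt_trichotomy x 0 with h | rfl | h
  · rw [abs_of_neg h, Real.sign_of_neg h, neg_one_mul]
  · simp
  · rw [abs_of_pos h, Real.sign_of_pos h, one_mul]

lemma integral_sharp_fluxKernel_mul_dw {ε : ℝ} (h0 : 0 < ε) (h1 : ε < 1) {u p q F φ : ℝ × ℝ → ℝ}
    {R : ℝ → ℝ → ℝ → ℝ → ℝ} (hRu : ∀ w z, R 0 0 w z = u (w, z))
    (hu : IsGoursatSolution ε 0 0 u p q) (hF : ContDiff ℝ ∞ F)
    (hFp : HasPartials F (fun x => lam2 ε x.1 x.2 * p x) (fun x => lam1 ε x.1 x.2 * q x))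
    (hFz : ∀ z, F (0, z) = lam2 ε 0 z * u (0, z) - 1) (hφ : IsTestFunction nonunitDensity φ) :
    -∫ p, sharp (entropyKernel R) (fluxKernel F) p * dw φ p =
      (∫ z, C5 ε z * Real.exp (-(1 + ε) ^ 2 * z / 4) * φ (0, z)) +
        ∫ p in {p : ℝ × ℝ | p.1 * p.2 < 0}, C3 ε R p * φ p := by
  have cF : ContDiff ℝ 1 F := by exact_mod_cast contDiff_infty.1 hF 1
  have cu : ContDiff ℝ 1 u := by exact_mod_cast contDiff_infty.1 hu.contDiff 1
  have hχ := entropyKernel_eq_indicator hRu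
  rw [integral_piecewise_mul_dw (G := fun p => F p + 1 - (p.1 + p.2) / 2 * u p) (by fun_prop)
    hφ.contDiff_one hφ.hasCompactSupport hφ.eq_zero_of_diagonal 1 (fun p hp => by
      rw [sharp, fluxKernel_eq_w hp, hχ]
      simp only [Set.indicator]
      split_ifs <;> ring), sub_eq_neg_add, ← integral_neg]
  congr 1
  -- The mass on `w = 0` has density `-(sgn z)(λ₂ - z / 2) u(0, z)`; the denominator of `λ₂` cancels
  -- a factor of `u(0, z)`, leaving `C5` times the exponential.
  · congr 1
    funext z
    simp only [hFz, hu.on_line_w, zero_add, add_zero, mul_zero, Real.exp_zero, C5, lam2, sub_zero,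
      abs_eq_sign_mul]
    rw [show -(1 + ε) ^ 2 * z / 4 = -((1 + ε) ^ 2 / 4) * z by ring]
    have := denom2_pos h0 h1 (ε * z)
    field_simp
    ring
  · refine setIntegral_congr_fun measurableSet_mul_neg fun x hx => ?_
    have hx : x.1 * x.2 < 0 := hx
    have hd : dw (fun p => F p + 1 - (p.1 + p.2) / 2 * u p) x =
        lam2 ε x.1 x.2 * p x - (1 / 2 * u x + (x.1 + x.2) / 2 * p x) :=
      (((hFp.add_const 1).hasDerivAt_fst x.1 x.2).sub
        (((((hasDerivAt_id x.1).add_const x.2).div_const 2)).mul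
          (hu.hasPartials.hasDerivAt_fst x.1 x.2))).deriv
    have hC : C1 R x = p x := by
      simp only [C1, hRu]
      exact hu.hasPartials.dw_eq x
    simp only [hd, C3, hC, hχ, Set.indicator, Set.mem_ofPred_eq, hx.le, if_true]
    ring

lemma integral_sharp_fluxKernel_mul_dz {ε : ℝ} (h0 : 0 < ε) (h1 : ε < 1) {u p q F φ : ℝ × ℝ → ℝ}
    {R : ℝ → ℝ → ℝ → ℝ → ℝ} (hRu : ∀ w z, R 0 0 w z = u (w, z))
    (hu : IsGoursatSolution ε 0 0 u p q) (hF : ContDiff ℝ ∞ F)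
    (hFp : HasPartials F (fun x => lam2 ε x.1 x.2 * p x) (fun x => lam1 ε x.1 x.2 * q x))
    (hFw : ∀ w, F (w, 0) = lam1 ε w 0 * u (w, 0) + 1) (hφ : IsTestFunction nonunitDensity φ) :
    -∫ p, sharp (entropyKernel R) (fluxKernel F) p * dz φ p =
      (∫ w, C6 ε w * Real.exp ((1 - ε) ^ 2 * w / 4) * φ (w, 0)) +
        ∫ p in {p : ℝ × ℝ | p.1 * p.2 < 0}, C4 ε R p * φ p := by
  have cF : ContDiff ℝ 1 F := by exact_mod_cast contDiff_infty.1 hF 1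
  have cu : ContDiff ℝ 1 u := by exact_mod_cast contDiff_infty.1 hu.contDiff 1
  have hχ := entropyKernel_eq_indicator hRu
  rw [integral_piecewise_mul_dz (G := fun p => F p - 1 - (p.1 + p.2) / 2 * u p) (by fun_prop)
    hφ.contDiff_one hφ.hasCompactSupport hφ.eq_zero_of_diagonal (-1) (fun p hp => by
      rw [sharp, fluxKernel_eq_z hp, hχ]
      simp only [Set.indicator]
      split_ifs <;> ring), sub_eq_neg_add, ← integral_neg]
  congr 1
  · congr 1
    funext w
    simp only [hFw, hu.on_line_z, add_zero, mul_zero, Real.exp_zero, C6, lam1, sub_zero,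
      abs_eq_sign_mul]
    rw [show (1 - ε) ^ 2 * w / 4 = (1 - ε) ^ 2 / 4 * w by ring]
    have := denom1_pos h0 h1 (ε * w)
    field_simp
    ring
  · refine setIntegral_congr_fun measurableSet_mul_neg fun x hx => ?_
    have hx : x.1 * x.2 < 0 := hx
    have hd : dz (fun p => F p - 1 - (p.1 + p.2) / 2 * u p) x =
        lam1 ε x.1 x.2 * q x - (1 / 2 * u x + (x.1 + x.2) / 2 * q x) :=
      (((hFp.add_const (-1)).hasDerivAt_snd x.1 x.2).sub
        (((((hasDerivAt_id x.2).const_add x.1).div_const 2)).mul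
          (hu.hasPartials.hasDerivAt_snd x.1 x.2))).deriv
    have hC : C2 R x = q x := by
      simp only [C2, hRu]
      exact hu.hasPartials.dz_eq x
    simp only [hd, C4, hC, hχ, Set.indicator, Set.mem_ofPred_eq, hx.le, if_true]
    ring

end RelEuler

theorem lemma3p4 (ε : ℝ) (hε0 : 0 < ε) (hε1 : ε < 1) :
    (∃! R, RelEuler.IsRiemannFunction ε R) ∧
    ∀ R, RelEuler.IsRiemannFunction ε R →
      ContDiff ℝ ∞ (fun p : ℝ × ℝ => R 0 0 p.1 p.2) ∧
      (∃ σ, RelEuler.IsEntropyFluxKernel ε (RelEuler.entropyKernel R) σ) ∧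
      (∀ σ σ', RelEuler.IsEntropyFluxKernel ε (RelEuler.entropyKernel R) σ →
        RelEuler.IsEntropyFluxKernel ε (RelEuler.entropyKernel R) σ' → σ =ᵐ[volume] σ') ∧
      ∀ σ, RelEuler.IsEntropyFluxKernel ε (RelEuler.entropyKernel R) σ →
        ∀ φ, RelEuler.IsTestFunction RelEuler.nonunitDensity φ →
          (-∫ p, RelEuler.sharp (RelEuler.entropyKernel R) σ p * RelEuler.dw φ p =
            (∫ z, RelEuler.C5 ε z * Real.exp (-(1 + ε) ^ 2 * z / 4) * φ (0, z)) +
              ∫ p in {p : ℝ × ℝ | p.1 * p.2 < 0}, RelEuler.C3 ε R p * φ p) ∧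
          (-∫ p, RelEuler.sharp (RelEuler.entropyKernel R) σ p * RelEuler.dz φ p =
            (∫ w, RelEuler.C6 ε w * Real.exp ((1 - ε) ^ 2 * w / 4) * φ (w, 0)) +
              ∫ p in {p : ℝ × ℝ | p.1 * p.2 < 0}, RelEuler.C4 ε R p * φ p) := by
  refine ⟨RelEuler.existsUnique_isRiemannFunction hε0 hε1, fun R hR => ?_⟩
  obtain ⟨u, p, q, hu⟩ := RelEuler.exists_isGoursatSolution hε0 hε1 0 0
  obtain ⟨F, hF, hFp, hFw, hFz, hF0⟩ := hu.exists_flux hε0 hε1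
  have hRu := hR.eq_goursat hε0 hε1 hu
  have hσ := RelEuler.isEntropyFluxKernel_fluxKernel hε0 hε1 hu hF hFp hFw hFz hF0
  rw [← RelEuler.entropyKernel_eq_indicator hRu] at hσ
  refine ⟨by simpa only [hRu] using hu.contDiff, ⟨_, hσ⟩, fun σ σ' h h' => h.ae_eq h',
    fun σ h φ hφ => ?_⟩
  -- By uniqueness, an arbitrary flux kernel may be replaced by the explicit one under the
  -- integrals.
  have hae : RelEuler.sharp (RelEuler.entropyKernel R) σ =ᵐ[volume]
      RelEuler.sharp (RelEuler.entropyKernel R) (RelEuler.fluxKernel F) := by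
    filter_upwards [h.ae_eq hσ] with x hx
    simp [RelEuler.sharp, hx]
  rw [← RelEuler.integral_sharp_fluxKernel_mul_dw hε0 hε1 hRu hu hF hFp hFz hφ,
    ← RelEuler.integral_sharp_fluxKernel_mul_dz hε0 hε1 hRu hu hF hFp hFw hφ]
  constructor <;> congr 1 <;> refine integral_congr_ae ?_ <;> filter_upwards [hae] with x hx <;>
    rw [hx]
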